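/- **Theorem 3.1.** Let $0<b<\infty$ and $\sigma\in L_2(0,b)$. For $y\in W^1_2[0,b]$ put $$U(y)=y(0)-\int_0^b\bigl(-i\,y'(x)\bigr)\overline{\sigma(x)}\,dx ,$$ and let $L$ be the operator $Ly=-i\,y'$ in $L_2(0,b)$ with domain $D(L)=\{y\in W^1_2[0,b]: U(y)=0\}$. Let $\Delta(\lambda)=1-\lambda\int_0^b e^{i\lambda x}\,\overline{\sigma(x)}\,dx$. For $f,g\in W_2^1[0,b]$ define the convolution $$(f*g)(x)=i\int_0^x f(x-\xi)g(\xi)\,d\xi-\int_0^b\overline{\sigma(\mu)}\,\frac{\partial}{\partial\mu}\Bigl(\int_\mu^x f(x-\xi+\mu)g(\xi)\,d\xi\Bigr)d\mu ,\qquad 0\le x\le b .$$ For $\lambda_n$ in the spectrum $\sigma(L)$ let $m_n$ be the multiplicity of $\lambda_n$ as a zero of $\Delta$, let $d_{j,n}$ be defined by $\frac{(\lambda-\lambda_n)^{m_n}}{\Delta(\lambda)}=\sum_{j\ge0}\frac{d_{j,n}}{j!}(\lambda-\lambda_n)^j$ near $\lambda_n$, and put, for $0\le s\le m_n-1$, $$u_{s,n}(x)=-\sum_{j=0}^{s}\frac{d_{j,n}}{j!}\,\frac{(ix)^{s-j}}{(s-j)!}\,e^{i\lambda_n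 x},\qquad P_nf=-\frac1{2\pi i}\oint_{|\lambda-\lambda_n|=\delta}(L-\lambda I)^{-1}f\,d\lambda\quad(f\in L_2(0,b)),$$ where $\delta>0$ is so small that $\lambda_n$ is the only point of $\sigma(L)$ in $|\lambda-\lambda_n|\le\delta$. Then such a $\delta$ exists for every $\lambda_n\in\sigma(L)$, and for every $f\in L_2(0,b)$ there are unique numbers $C_{0,n}(f),\dots,C_{m_n-1,n}(f)\in\mathbb C$ with $$P_nf=C_{m_n-1,n}(f)\,u_{0,n}+C_{m_n-2,n}(f)\,u_{1,n}+\dots+C_{0,n}(f)\,u_{m_n-1,n},$$ so that the Fourier transform $$\widehat f=\{(C_{0,n}(f),\dots,C_{m_n-1,n}(f)):\lambda_n\in\sigma(L)\}\in X:=\prod_{\lambda_n\in\sigma(L)}\mathbb C^{m_n}$$ is well defined on $L_2(0,b)$. Moreover, for all $f,g\in W^1_2[0,b]$ we have $f*g\in L_2(0,b)$ and $$\widehat{f*g}=\widehat f*_X\widehat g ,$$ where $*_X$ is the blockwise truncated Cauchy product $(\xi*_X\eta)_{k,n}=\sum_{j=0}^{k}\xi_{j,n}\,\eta_{k-j,n}$,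 $0\le k\le m_n-1$. -/

import Mathlib

open MeasureTheory Set Filter Topology

noncomputable section

namespace BoundaryConv

/-- Lebesgue measure on the interval (as a null set, the end point `b` is immaterial). -/
abbrev μI (b : ℝ) : Measure ℝ := volume.restrict (Ioc 0 b)

/-- The complex Hilbert space `L₂(0,b)`. -/
abbrev L2 (b : ℝ) : Type := Lp ℂ 2 (μI b)

/-! ### The Sobolev space `W¹₂[0,b]` -/

/-- `f ∈ W¹₂[0,b]` (continuous representative): on `[0,b]` the function is absolutely continuous,
i.e. the indefinite integral of an integrable function, and this derivative lies in `L₂(0,b)`.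
Only the values of `f` on `[0,b]` matter. -/
def IsW12 (b : ℝ) (f : ℝ → ℂ) : Prop :=
  ∃ h : L2 b, ∀ x ∈ Icc 0 b, f x = f 0 + ∫ t in (0 : ℝ)..x, h t

theorem L2.integrable {b : ℝ} (h : L2 b) : Integrable h (μI b) :=
  (Lp.memLp h).integrable (by norm_num)

theorem L2.intervalIntegrable {b : ℝ} (hb : 0 ≤ b) (h : L2 b) :
    IntervalIntegrable h volume 0 b :=
  (intervalIntegrable_iff_integrableOn_Ioc_of_le hb).2 (L2.integrable h)

theorem continuousOn_of_primitive {b : ℝ} {f : ℝ → ℂ} {h : L2 b}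
    (hf : ∀ x ∈ Icc 0 b, f x = f 0 + ∫ t in (0 : ℝ)..x, h t) : ContinuousOn f (Icc 0 b) := by
  rcases lt_or_ge b 0 with hb | hb
  · simp [Icc_eq_empty_of_lt hb]
  have hi : IntegrableOn h (uIcc 0 b) := by
    rw [uIcc_of_le hb, integrableOn_Icc_iff_integrableOn_Ioc]
    exact L2.integrable h
  have := intervalIntegral.continuousOn_primitive_interval hi
  rw [uIcc_of_le hb] at this
  exact (continuousOn_const.add this).congr hf

theorem IsW12.continuousOn {b : ℝ} {f : ℝ → ℂ} (hf : IsW12 b f) : ContinuousOn f (Icc 0 b) := by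
  obtain ⟨h, hh⟩ := hf
  exact continuousOn_of_primitive hh

theorem memLp_of_continuousOn {b : ℝ} {f : ℝ → ℂ} (hf : ContinuousOn f (Icc 0 b)) :
    MemLp f 2 (μI b) := by
  obtain ⟨C, hC⟩ := isCompact_Icc.exists_bound_of_continuousOn hf
  refine MemLp.of_bound ((hf.mono Ioc_subset_Icc_self).aestronglyMeasurable measurableSet_Ioc) C ?_
  filter_upwards [ae_restrict_mem measurableSet_Ioc] with x hx
  exact hC x (Ioc_subset_Icc_self hx)

theorem IsW12.memLp {b : ℝ} {f : ℝ → ℂ} (hf : IsW12 b f) : MemLp f 2 (μI b) :=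
  memLp_of_continuousOn hf.continuousOn

theorem ae_mem_Ioo (b : ℝ) : ∀ᵐ x ∂(μI b), x ∈ Ioo 0 b := by
  rw [μI, Measure.restrict_congr_set Ioo_ae_eq_Ioc.symm]
  exact ae_restrict_mem measurableSet_Ioo

theorem ae_hasDerivAt {b : ℝ} {f : ℝ → ℂ} {h : L2 b}
    (hf : ∀ x ∈ Icc 0 b, f x = f 0 + ∫ t in (0 : ℝ)..x, h t) :
    ∀ᵐ x ∂(μI b), HasDerivAt f (h x) x := by
  rcases lt_or_ge b 0 with hb | hb
  · simp [μI, Ioc_eq_empty_of_le hb.le]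
  have h1 := ae_restrict_of_ae (s := Ioc 0 b)
    (L2.intervalIntegrable hb h).ae_hasDerivAt_integral
  filter_upwards [h1, ae_mem_Ioo b] with x hx hx'
  rw [uIcc_of_le hb] at hx
  have h2 := (hx (Ioo_subset_Icc_self hx') 0 ⟨le_rfl, hb⟩).const_add (f 0)
  refine h2.congr_of_eventuallyEq ?_
  filter_upwards [Ioo_mem_nhds hx'.1 hx'.2] with y hy
  exact hf y (Ioo_subset_Icc_self hy)

theorem IsW12.memLp_deriv {b : ℝ} {f : ℝ → ℂ} (hf : IsW12 b f) : MemLp (deriv f) 2 (μI b) := by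
  obtain ⟨h, hh⟩ := hf
  refine (Lp.memLp h).ae_eq ?_
  filter_upwards [ae_hasDerivAt hh] with x hx
  exact hx.deriv.symm

theorem IsW12.ae_differentiableAt {b : ℝ} {f : ℝ → ℂ} (hf : IsW12 b f) :
    ∀ᵐ x ∂(μI b), DifferentiableAt ℝ f x := by
  obtain ⟨h, hh⟩ := hf
  filter_upwards [ae_hasDerivAt hh] with x hx
  exact hx.differentiableAt

theorem IsW12.add {b : ℝ} {f g : ℝ → ℂ} (hf : IsW12 b f) (hg : IsW12 b g) :
    IsW12 b (f + g) := by
  obtain ⟨h, hh⟩ := hf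
  obtain ⟨k, hk⟩ := hg
  refine ⟨h + k, fun x hx => ?_⟩
  have hb : 0 ≤ b := hx.1.trans hx.2
  have hsub : Ioc 0 x ⊆ Ioc 0 b := Ioc_subset_Ioc_right hx.2
  have e : ∫ t in (0 : ℝ)..x, (h + k : L2 b) t = ∫ t in (0 : ℝ)..x, (h t + k t) := by
    rw [intervalIntegral.integral_of_le hx.1, intervalIntegral.integral_of_le hx.1]
    exact integral_congr_ae (ae_restrict_of_ae_restrict_of_subset hsub (Lp.coeFn_add h k))
  rw [e, intervalIntegral.integral_add, Pi.add_apply, Pi.add_apply, hh x hx, hk x hx]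
  · ring
  · exact (intervalIntegrable_iff_integrableOn_Ioc_of_le hx.1).2
      (IntegrableOn.mono_set (L2.integrable h) hsub)
  · exact (intervalIntegrable_iff_integrableOn_Ioc_of_le hx.1).2
      (IntegrableOn.mono_set (L2.integrable k) hsub)

theorem IsW12.smul {b : ℝ} {f : ℝ → ℂ} (c : ℂ) (hf : IsW12 b f) : IsW12 b (c • f) := by
  obtain ⟨h, hh⟩ := hf
  refine ⟨c • h, fun x hx => ?_⟩
  have hsub : Ioc 0 x ⊆ Ioc 0 b := Ioc_subset_Ioc_right hx.2
  have e : ∫ t in (0 : ℝ)..x, (c • h : L2 b) t = ∫ t in (0 : ℝ)..x, c • h t := by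
    rw [intervalIntegral.integral_of_le hx.1, intervalIntegral.integral_of_le hx.1]
    exact integral_congr_ae (ae_restrict_of_ae_restrict_of_subset hsub (Lp.coeFn_smul c h))
  rw [e, intervalIntegral.integral_smul, Pi.smul_apply, Pi.smul_apply, hh x hx, smul_add]

theorem IsW12.zero (b : ℝ) : IsW12 b 0 := by
  refine ⟨0, fun x hx => ?_⟩
  have hsub : Ioc 0 x ⊆ Ioc 0 b := Ioc_subset_Ioc_right hx.2
  have e : ∫ t in (0 : ℝ)..x, (0 : L2 b) t = ∫ t in (0 : ℝ)..x, (0 : ℂ) := by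
    rw [intervalIntegral.integral_of_le hx.1, intervalIntegral.integral_of_le hx.1]
    exact integral_congr_ae
      (ae_restrict_of_ae_restrict_of_subset hsub (Lp.coeFn_zero ℂ 2 (μI b)))
  rw [e]
  simp

theorem IsW12.deriv_ae_congr {b : ℝ} {f g : ℝ → ℂ} (hf : IsW12 b f) (hg : IsW12 b g)
    (h : f =ᵐ[μI b] g) : deriv f =ᵐ[μI b] deriv g := by
  have h' : f =ᵐ[volume.restrict (Ioo 0 b)] g := by
    rwa [Measure.restrict_congr_set Ioo_ae_eq_Ioc]
  have he : EqOn f g (Ioo 0 b) := Measure.eqOn_Ioo_of_ae_eq volume h'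
    (hf.continuousOn.mono Ioo_subset_Icc_self) (hg.continuousOn.mono Ioo_subset_Icc_self)
  filter_upwards [ae_mem_Ioo b] with x hx
  refine EventuallyEq.deriv_eq ?_
  filter_upwards [Ioo_mem_nhds hx.1 hx.2] with y hy
  exact he hy

/-! ### The operator `L` -/

/-- The boundary form `U(y) = y(0) - ∫₀ᵇ (-i y'(x)) conj σ(x) dx`. -/
def bdry (b : ℝ) (σ : L2 b) (y : ℝ → ℂ) : ℂ :=
  y 0 - ∫ x in (0 : ℝ)..b, (-Complex.I * deriv y x) * (starRingEnd ℂ) (σ x)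

theorem integrable_bdry {b : ℝ} (σ : L2 b) {y : ℝ → ℂ} (hy : IsW12 b y) :
    Integrable (fun x => (-Complex.I * deriv y x) * (starRingEnd ℂ) (σ x)) (μI b) :=
  (hy.memLp_deriv.const_mul (-Complex.I)).integrable_mul (Lp.memLp σ).star

theorem bdry_add {b : ℝ} (hb : 0 ≤ b) (σ : L2 b) {y z : ℝ → ℂ} (hy : IsW12 b y)
    (hz : IsW12 b z) : bdry b σ (y + z) = bdry b σ y + bdry b σ z := by
  have e : ∫ x in (0 : ℝ)..b, (-Complex.I * deriv (y + z) x) * (starRingEnd ℂ) (σ x) =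
      (∫ x in (0 : ℝ)..b, (-Complex.I * deriv y x) * (starRingEnd ℂ) (σ x)) +
      ∫ x in (0 : ℝ)..b, (-Complex.I * deriv z x) * (starRingEnd ℂ) (σ x) := by
    simp only [intervalIntegral.integral_of_le hb]
    rw [← integral_add (integrable_bdry σ hy) (integrable_bdry σ hz)]
    refine integral_congr_ae ?_
    filter_upwards [hy.ae_differentiableAt, hz.ae_differentiableAt] with x h1 h2
    rw [deriv_add h1 h2]
    ring
  rw [bdry, e, bdry, bdry, Pi.add_apply]
  ring

theorem bdry_smul {b : ℝ} (hb : 0 ≤ b) (σ : L2 b) (c : ℂ) {y : ℝ → ℂ} (hy : IsW12 b y) :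
    bdry b σ (c • y) = c * bdry b σ y := by
  have e : ∫ x in (0 : ℝ)..b, (-Complex.I * deriv (c • y) x) * (starRingEnd ℂ) (σ x) =
      c * ∫ x in (0 : ℝ)..b, (-Complex.I * deriv y x) * (starRingEnd ℂ) (σ x) := by
    simp only [intervalIntegral.integral_of_le hb]
    rw [← integral_const_mul]
    refine integral_congr_ae ?_
    filter_upwards [hy.ae_differentiableAt] with x h1
    rw [deriv_const_smul c h1, smul_eq_mul]
    ring
  rw [bdry, e, bdry, Pi.smul_apply, smul_eq_mul]
  ring

/-- `Y` is a `W¹₂[0,b]` representative of the class `y ∈ L₂(0,b)` satisfying `U(Y) = 0`. -/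
def IsDomRep (b : ℝ) (σ : L2 b) (y : L2 b) (Y : ℝ → ℂ) : Prop :=
  IsW12 b Y ∧ bdry b σ Y = 0 ∧ y =ᵐ[μI b] Y

theorem IsDomRep.add {b : ℝ} (hb : 0 ≤ b) {σ y z : L2 b} {Y Z : ℝ → ℂ}
    (h : IsDomRep b σ y Y) (k : IsDomRep b σ z Z) : IsDomRep b σ (y + z) (Y + Z) := by
  refine ⟨h.1.add k.1, ?_, (Lp.coeFn_add y z).trans (h.2.2.add k.2.2)⟩
  rw [bdry_add hb σ h.1 k.1, h.2.1, k.2.1, add_zero]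

theorem IsDomRep.smul {b : ℝ} (hb : 0 ≤ b) (c : ℂ) {σ y : L2 b} {Y : ℝ → ℂ}
    (h : IsDomRep b σ y Y) : IsDomRep b σ (c • y) (c • Y) := by
  refine ⟨h.1.smul c, ?_, (Lp.coeFn_smul c y).trans (h.2.2.const_smul c)⟩
  rw [bdry_smul hb σ c h.1, h.2.1, mul_zero]

/-- The class `-i Y'` in `L₂(0,b)` of a `W¹₂[0,b]` function `Y`. -/
def negIDeriv {b : ℝ} (Y : ℝ → ℂ) (hY : IsW12 b Y) : L2 b :=
  (hY.memLp_deriv.const_mul (-Complex.I)).toLp (fun x => -Complex.I * deriv Y x)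

theorem negIDeriv_eq {b : ℝ} {Y Z : ℝ → ℂ} (hY : IsW12 b Y) (hZ : IsW12 b Z)
    (h : Y =ᵐ[μI b] Z) : negIDeriv Y hY = negIDeriv Z hZ := by
  refine (MemLp.toLp_eq_toLp_iff _ _).2 ?_
  filter_upwards [hY.deriv_ae_congr hZ h] with x hx
  rw [hx]

/-- The operator `L y = -i dy/dx` in `L₂(0,b)` with domain `{y ∈ W¹₂[0,b] : U(y) = 0}`. -/
def Lop (b : ℝ) (hb : 0 < b) (σ : L2 b) : L2 b →ₗ.[ℂ] L2 b where
  domain :=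
    { carrier := {y | ∃ Y, IsDomRep b σ y Y}
      add_mem' := by
        rintro y z ⟨Y, hY⟩ ⟨Z, hZ⟩
        exact ⟨Y + Z, hY.add hb.le hZ⟩
      zero_mem' := by
        refine ⟨0, IsW12.zero b, ?_, Lp.coeFn_zero ℂ 2 (μI b)⟩
        have := bdry_smul hb.le σ 0 (IsW12.zero b)
        rwa [smul_zero, zero_mul] at this
      smul_mem' := by
        rintro c y ⟨Y, hY⟩
        exact ⟨c • Y, hY.smul hb.le c⟩ }
  toFun :=
    { toFun := fun y => negIDeriv y.2.choose y.2.choose_spec.1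
      map_add' := by
        intro y z
        have hy := y.2.choose_spec
        have hz := z.2.choose_spec
        have hs := (y + z).2.choose_spec
        have h1 : negIDeriv _ hs.1 = negIDeriv _ (hy.add hb.le hz).1 :=
          negIDeriv_eq _ _ (hs.2.2.symm.trans (hy.add hb.le hz).2.2)
        rw [h1]
        refine Eq.trans ?_ (MemLp.toLp_add _ _)
        refine (MemLp.toLp_eq_toLp_iff _ _).2 ?_
        filter_upwards [hy.1.ae_differentiableAt, hz.1.ae_differentiableAt] with x e1 e2
        rw [deriv_add e1 e2, Pi.add_apply]
        ring
      map_smul' := by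
        intro c y
        have hy := y.2.choose_spec
        have hs := (c • y).2.choose_spec
        have h1 : negIDeriv _ hs.1 = negIDeriv _ (hy.smul hb.le c).1 :=
          negIDeriv_eq _ _ (hs.2.2.symm.trans (hy.smul hb.le c).2.2)
        rw [h1]
        refine Eq.trans ?_ (MemLp.toLp_const_smul c _)
        refine (MemLp.toLp_eq_toLp_iff _ _).2 ?_
        filter_upwards [hy.1.ae_differentiableAt] with x e1
        rw [deriv_const_smul c e1, Pi.smul_apply, smul_eq_mul, smul_eq_mul]
        ring }

/-- The value of `L` does not depend on the chosen representative. -/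
theorem Lop_apply {b : ℝ} (hb : 0 < b) (σ : L2 b) (y : (Lop b hb σ).domain) {Y : ℝ → ℂ}
    (hY : IsDomRep b σ y Y) : Lop b hb σ y = negIDeriv Y hY.1 :=
  negIDeriv_eq y.2.choose_spec.1 hY.1 (y.2.choose_spec.2.2.symm.trans hY.2.2)

/-! ### Resolvent, spectrum and Riesz projections of an unbounded operator -/

section Operator

variable {E : Type*} [NormedAddCommGroup E] [NormedSpace ℂ E]

/-- `R` is a bounded everywhere defined two-sided inverse of `A - z I`. -/
def IsResolvent (A : E →ₗ.[ℂ] E) (z : ℂ) (R : E →L[ℂ] E) : Prop :=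
  (∀ f : E, ∃ h : R f ∈ A.domain, A ⟨R f, h⟩ - z • R f = f) ∧
  (∀ y : A.domain, R (A y - z • (y : E)) = y)

/-- The spectrum of `A`: the complement of the resolvent set. -/
def spec (A : E →ₗ.[ℂ] E) : Set ℂ := {z | ¬ ∃ R : E →L[ℂ] E, IsResolvent A z R}

/-- The resolvent `(A - z I)⁻¹` (zero on the spectrum, where it is not used). -/
def resolv (A : E →ₗ.[ℂ] E) (z : ℂ) : E →L[ℂ] E :=
  open Classical in if h : ∃ R : E →L[ℂ] E, IsResolvent A z R then h.choose else 0

/-- The closed disc of radius `δ` about `w` meets the spectrum at most in `w`. -/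
def IsIsolatingRadius (A : E →ₗ.[ℂ] E) (w : ℂ) (δ : ℝ) : Prop :=
  0 < δ ∧ ∀ z ∈ spec A, z ∈ Metric.closedBall w δ → z = w

/-- A small radius about `w`. -/
def isolatingRadius (A : E →ₗ.[ℂ] E) (w : ℂ) : ℝ :=
  Classical.epsilon (IsIsolatingRadius A w)

/-- The Riesz projection `P f = -(2πi)⁻¹ ∮_{|z-w|=δ} (A - zI)⁻¹ f dz`. -/
def rieszProj (A : E →ₗ.[ℂ] E) (w : ℂ) (f : E) : E :=
  (-(2 * (Real.pi : ℂ) * Complex.I)⁻¹) • ∮ z in C(w, isolatingRadius A w), resolv A z f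

end Operator

/-! ### Characteristic function and root functions -/

/-- The entire function `Δ(z) = 1 - z ∫₀ᵇ exp(izx) conj σ(x) dx`. -/
def charFn (b : ℝ) (σ : L2 b) (z : ℂ) : ℂ :=
  1 - z * ∫ x in (0 : ℝ)..b, Complex.exp (Complex.I * z * x) * (starRingEnd ℂ) (σ x)

/-- The multiplicity `m` of `w` as a zero of `Δ`. -/
def mult (b : ℝ) (σ : L2 b) (w : ℂ) : ℕ := analyticOrderNatAt (charFn b σ) w

/-- The coefficient `d_j` in the Taylor series `∑ (d_j / j!) (z - w)^j` of the function
`(z - w)^m / Δ(z)`, i.e. the value at the removable singularity `w` of its `j`-th derivative. -/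
def taylorCoeff (b : ℝ) (σ : L2 b) (w : ℂ) (j : ℕ) : ℂ :=
  limUnder (𝓝[≠] w) fun z =>
    iteratedDeriv j (fun ζ : ℂ => (ζ - w) ^ mult b σ w / charFn b σ ζ) z

/-- The root function `u_s` at the eigenvalue `w`. The overall minus sign is that of
`P f = -(2πi)⁻¹ ∮ (L - zI)⁻¹ f dz = -Res (L - zI)⁻¹ f`. -/
def rootFn (b : ℝ) (σ : L2 b) (w : ℂ) (s : ℕ) (x : ℝ) : ℂ :=
  -∑ j ∈ Finset.range (s + 1), taylorCoeff b σ w j / (Nat.factorial j : ℂ) *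
    ((Complex.I * x) ^ (s - j) / (Nat.factorial (s - j) : ℂ)) * Complex.exp (Complex.I * w * x)

/-! ### Convolution and Fourier transform -/

/-- The convolution
`(g ∗ f)(x) = i ∫₀ˣ g(x-ξ) f(ξ) dξ - ∫₀ᵇ conj σ(μ) ∂/∂μ (∫_μ^x g(x-ξ+μ) f(ξ) dξ) dμ`. -/
def conv (b : ℝ) (σ : L2 b) (g f : ℝ → ℂ) (x : ℝ) : ℂ :=
  Complex.I * (∫ ξ in (0 : ℝ)..x, g (x - ξ) * f ξ) -
    ∫ μ in (0 : ℝ)..b, (starRingEnd ℂ) (σ μ) *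
      deriv (fun t : ℝ => ∫ ξ in t..x, g (x - ξ + t) * f ξ) μ

/-- The sequence space `X = ∏_{w ∈ spec L} ℂ^{m(w)}`. -/
abbrev SeqSpace (b : ℝ) (hb : 0 < b) (σ : L2 b) : Type :=
  (w : spec (Lop b hb σ)) → Fin (mult b σ w) → ℂ

/-- `c = (C_0, …, C_{m-1})` are the coefficients in
`P f = C_{m-1} u_0 + C_{m-2} u_1 + … + C_0 u_{m-1}` at `w`. -/
def IsRootCoeff (b : ℝ) (hb : 0 < b) (σ : L2 b) (w : ℂ) (f : L2 b)
    (c : Fin (mult b σ w) → ℂ) : Prop :=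
  (rieszProj (Lop b hb σ) w f : L2 b) =ᵐ[μI b]
    fun x => ∑ k : Fin (mult b σ w), c (Fin.rev k) * rootFn b σ w k x

/-- The Fourier transform: the family of the coefficients of all projections `P f`. -/
def fourier (b : ℝ) (hb : 0 < b) (σ : L2 b) (f : L2 b) : SeqSpace b hb σ :=
  fun w => Classical.epsilon (IsRootCoeff b hb σ w f)

/-- The blockwise truncated Cauchy product on `X`. -/
def cauchyProd {b : ℝ} {hb : 0 < b} {σ : L2 b} (ξ η : SeqSpace b hb σ) : SeqSpace b hb σ :=
  fun w k => ∑ p : Fin (mult b σ w) × Fin (mult b σ w),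
    if (p.1 : ℕ) + p.2 = k then ξ w p.1 * η w p.2 else 0

end BoundaryConv

end

noncomputable section

namespace BoundaryConv

/-! Let `V h = i ∫₀ˣ h`, `e = 1` and `S f = ∫₀ᵇ f conj σ`. The condition `U(y) = 0` says `y(0) = S(L
y)`, so `L` is the inverse of the rank one perturbation `V + e ⊗ S`. As `V` is quasinilpotent, `R(z)
= (1 - zV)⁻¹` is entire, `R(z) e = exp(izx)`, and `Δ(z) = 1 - z S(R(z) e)` is the perturbation
determinant. Hence `(L - z)⁻¹ f = V R(z) f + Δ(z)⁻¹ S(R(z) f) R(z) e`, and the spectrum is the zero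
set of `Δ`.

Only the second term has a residue at a zero `w`. Expanding the three factors `S(R(z) f)`, `(z -
w)^m / Δ(z)` and `R(z) e` there shows that the Fourier coefficients `C_k(f)`, `k < m`, are the
Taylor coefficients at `w` of `F_f(z) = S(R(z) f)` (`rieszProj_Lop`, `fourier_eq_coefFun`). They are
unique because `u_s` is an exponential times a polynomial of exact degree `s`.

Multiplicativity therefore means `F_{f∗g} = F_f F_g` modulo terms vanishing to order `m` at `w`. For
an exponential `f = e_a = R(a) e` the convolution is explicit, `e_a ∗ g = Δ(a) R(a) V g + S(R(a) g)
e_a` (`conv_expMon`), and the resolvent identity gives `F_{e_a∗g}(z) = F_{e_a}(z) F_g(z) + Δ(z)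
(F_g(a) - F_g(z)) / (a - z)` (`clm_resN_expConv`). For `a ≠ w` the last term vanishes to order `m`.

The passage to all `f ∈ W¹₂` is by density (`coefFun_convL`): with `f = c + V h`, both sides are
bounded and linear in `(c, h)`, and expansion in `a` near `0` reduces exponentials to polynomials.
Boundedness of `f ↦ f ∗ g` is the analytic point, since the definition differentiates an integral;
it follows from a Lipschitz estimate for that integral in its parameter (`norm_convKer_sub_le`). -/

/-! ### Taylor coefficients -/

/-- The `k`-th Taylor coefficient of `f` at `w`. -/
def taylorCoef {F : Type*} [NormedAddCommGroup F] [NormedSpace ℂ F] (k : ℕ) (f : ℂ → F) (w : ℂ) :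
    F :=
  ((k.factorial : ℂ)⁻¹) • iteratedDeriv k f w

section TaylorCoef

variable {F : Type*} [NormedAddCommGroup F] [NormedSpace ℂ F]

theorem taylorCoef_congr {k : ℕ} {f g : ℂ → F} {w : ℂ} (h : f =ᶠ[𝓝 w] g) :
    taylorCoef k f w = taylorCoef k g w := by
  rw [taylorCoef, h.iteratedDeriv_eq, taylorCoef]

theorem taylorCoef_add {k : ℕ} {f g : ℂ → F} {w : ℂ} (hf : ContDiffAt ℂ k f w)
    (hg : ContDiffAt ℂ k g w) :
    taylorCoef k (fun z => f z + g z) w = taylorCoef k f w + taylorCoef k g w := by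
  simp only [taylorCoef]
  rw [iteratedDeriv_fun_add hf hg, smul_add]

/-- Dividing by `k!` absorbs the binomial coefficients, so the Leibniz rule becomes a Cauchy
product; this is the source of the product on `X`. -/
theorem taylorCoef_smul {k : ℕ} {f : ℂ → ℂ} {g : ℂ → F} {w : ℂ} (hf : ContDiffAt ℂ k f w)
    (hg : ContDiffAt ℂ k g w) :
    taylorCoef k (fun z => f z • g z) w =
      ∑ p ∈ Finset.HasAntidiagonal.antidiagonal k, taylorCoef p.1 f w • taylorCoef p.2 g w := by
  have h := iteratedDerivWithin_smul (Set.mem_univ w) uniqueDiffOn_univ hf.contDiffWithinAt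
    hg.contDiffWithinAt
  simp only [iteratedDerivWithin_univ] at h
  rw [Finset.Nat.sum_antidiagonal_eq_sum_range_succ
    (fun i j => taylorCoef i f w • taylorCoef j g w), taylorCoef]
  change _ • iteratedDeriv k (f • g) w = _
  rw [h, Finset.smul_sum]
  refine Finset.sum_congr rfl fun i hi => ?_
  have hi : i ≤ k := Nat.lt_succ_iff.1 (Finset.mem_range.1 hi)
  simp only [taylorCoef]
  rw [← Nat.cast_smul_eq_nsmul ℂ (k.choose i), smul_assoc, smul_smul, smul_smul, smul_smul,
    smul_smul, Nat.cast_choose ℂ hi]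
  congr 1
  have h1 : (k.factorial : ℂ) ≠ 0 := Nat.cast_ne_zero.2 k.factorial_ne_zero
  field_simp

end TaylorCoef

/-! ### Rank one perturbations of a quasinilpotent operator -/

section Perturbation

variable {E : Type*} [NormedAddCommGroup E] [NormedSpace ℂ E]

/-- The inverse of `1 - z V`. -/
def resN (V : E →L[ℂ] E) (z : ℂ) : E →L[ℂ] E := Ring.inverse (1 - z • V)

theorem resN_zero (V : E →L[ℂ] E) : resN V 0 = 1 := by simp [resN]

variable {V : E →L[ℂ] E} (hV : ∀ z : ℂ, IsUnit (1 - z • V))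

include hV

theorem resN_mul_cancel (z : ℂ) : resN V z * (1 - z • V) = 1 := Ring.inverse_mul_cancel _ (hV z)

theorem mul_resN_cancel (z : ℂ) : (1 - z • V) * resN V z = 1 := Ring.mul_inverse_cancel _ (hV z)

theorem resN_sub_smul (z : ℂ) (x : E) : resN V z (x - z • V x) = x :=
  DFunLike.congr_fun (resN_mul_cancel hV z) x

theorem resN_eq_add (z : ℂ) (x : E) : resN V z x = x + z • V (resN V z x) := by
  have := DFunLike.congr_fun (mul_resN_cancel hV z) x
  rw [← sub_eq_iff_eq_add]
  exact this

theorem eq_resN_of_sub {z : ℂ} {x y : E} (h : y - z • V y = x) : y = resN V z x := by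
  rw [← h, resN_sub_smul hV]

theorem commute_resN (z : ℂ) : Commute V (resN V z) := by
  have h : Commute V (1 - z • V) :=
    (Commute.one_right V).sub_right ((Commute.refl V).smul_right z)
  obtain ⟨u, hu⟩ := hV z
  rw [resN, ← hu, Ring.inverse_unit]
  exact (hu ▸ h : Commute V (u : E →L[ℂ] E)).units_inv_right

theorem resN_apply_comm (z : ℂ) (x : E) : resN V z (V x) = V (resN V z x) :=
  (DFunLike.congr_fun (commute_resN hV z).eq x).symm

theorem resN_eq_add' (z : ℂ) (x : E) : resN V z x = x + z • resN V z (V x) := by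
  rw [resN_apply_comm hV, ← resN_eq_add hV]

/-- The resolvent identity. -/
theorem smul_resN_resN_apply (a z : ℂ) (x : E) :
    (a - z) • resN V z (resN V a (V x)) = resN V a x - resN V z x := by
  have h1 : resN V z (resN V a x - z • V (resN V a x)) = resN V a x := resN_sub_smul hV _ _
  have h2 := congrArg (resN V z) (resN_eq_add hV a x)
  rw [map_add, map_smul] at h2
  rw [map_sub, map_smul] at h1
  rw [resN_apply_comm hV a, sub_smul]
  nth_rewrite 3 [← h1]
  rw [h2]
  abel

variable [CompleteSpace E]

theorem hasDerivAt_resN (z : ℂ) : HasDerivAt (resN V) (V * resN V z ^ 2) z := by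
  obtain ⟨u, hu⟩ := hV z
  have h1 : HasFDerivAt (Ring.inverse : (E →L[ℂ] E) → _) _ (1 - z • V) :=
    hu ▸ hasFDerivAt_ringInverse (𝕜 := ℂ) u
  have h2 : HasDerivAt (fun z : ℂ => 1 - z • V) (-V) z := by
    simpa using ((hasDerivAt_id z).smul_const V).const_sub 1
  have h3 := h1.comp_hasDerivAt z h2
  refine (h3.congr_deriv ?_)
  have hu' : (↑u⁻¹ : E →L[ℂ] E) = resN V z := by
    rw [resN, ← hu, Ring.inverse_unit]
  simp only [hu', neg_apply, ContinuousLinearMap.mulLeftRight_apply]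
  rw [mul_neg, neg_mul, neg_neg, ← (commute_resN hV z).eq, pow_two, mul_assoc]

theorem hasDerivAt_resN_pow (k : ℕ) (z : ℂ) :
    HasDerivAt (fun z => resN V z ^ k) ((k : ℂ) • (V * resN V z ^ (k + 1))) z := by
  induction k with
  | zero => simpa using hasDerivAt_const z (1 : E →L[ℂ] E)
  | succ k ih =>
    have h := ih.mul (hasDerivAt_resN hV z)
    have e : (fun z => resN V z ^ (k + 1)) = (fun z => resN V z ^ k) * resN V := by
      funext z; exact pow_succ _ _
    rw [e]
    refine h.congr_deriv ?_
    have hc : Commute V (resN V z ^ k) := (commute_resN hV z).pow_right k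
    rw [smul_mul_assoc, mul_assoc, ← pow_succ, ← mul_assoc, ← hc.eq, mul_assoc, ← pow_add,
      Nat.cast_succ, add_smul, one_smul]

theorem iteratedDeriv_resN (x : E) (k : ℕ) :
    iteratedDeriv k (fun z => resN V z x) =
      fun z => (k.factorial : ℂ) • (V ^ k * resN V z ^ (k + 1)) x := by
  induction k with
  | zero => simp
  | succ k ih =>
    rw [iteratedDeriv_succ, ih]
    funext z
    have h := ((((hasDerivAt_resN_pow hV (k + 1) z).const_mul (V ^ k)).clm_apply
      (hasDerivAt_const z x)).const_smul ((k.factorial : ℂ)))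
    refine h.deriv.trans ?_
    simp only [map_zero, add_zero]
    rw [mul_smul_comm, ← mul_assoc, ← pow_succ, smul_apply, smul_smul,
      Nat.factorial_succ, Nat.cast_mul, mul_comm ((k + 1 : ℕ) : ℂ)]

theorem taylorCoef_resN (x : E) (k : ℕ) (w : ℂ) :
    taylorCoef k (fun z => resN V z x) w = (V ^ k * resN V w ^ (k + 1)) x := by
  have h1 : (k.factorial : ℂ) ≠ 0 := Nat.cast_ne_zero.2 k.factorial_ne_zero
  rw [taylorCoef, iteratedDeriv_resN hV, smul_smul, inv_mul_cancel₀ h1, one_smul]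

theorem differentiable_resN_apply (x : E) : Differentiable ℂ fun z => resN V z x := fun z =>
  ((hasDerivAt_resN hV z).clm_apply (hasDerivAt_const z x)).differentiableAt

variable (S : E →L[ℂ] ℂ) (e : E)

theorem differentiable_clm_resN_apply (x : E) : Differentiable ℂ fun z => S (resN V z x) :=
  S.differentiable.comp (differentiable_resN_apply hV x)

omit hV in
/-- The Taylor coefficient functionals of `z ↦ S (1 - z V)⁻¹ x` at `w`. -/
def coefFun (V : E →L[ℂ] E) (S : E →L[ℂ] ℂ) (w : ℂ) (k : ℕ) : E →L[ℂ] ℂ :=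
  S ∘L (V ^ k * resN V w ^ (k + 1))

theorem taylorCoef_clm_resN (x : E) (k : ℕ) (w : ℂ) :
    taylorCoef k (fun z => S (resN V z x)) w = coefFun V S w k x := by
  have h : ∀ k, iteratedDeriv k (fun z => S (resN V z x)) =
      fun z => S (iteratedDeriv k (fun z => resN V z x) z) := by
    intro k
    induction k with
    | zero => simp
    | succ k ih =>
      funext z
      rw [iteratedDeriv_succ, ih, iteratedDeriv_succ]
      refine (S.hasFDerivAt.comp_hasDerivAt z (DifferentiableAt.hasDerivAt ?_)).deriv
      rw [iteratedDeriv_resN hV]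
      exact (((hasDerivAt_resN_pow hV (k + 1) z).const_mul (V ^ k)).clm_apply
        (hasDerivAt_const z x)).differentiableAt.const_smul _
  rw [taylorCoef, h, coefFun, ContinuousLinearMap.comp_apply, ← taylorCoef_resN hV, taylorCoef,
    map_smul]

omit hV in
/-- The perturbation determinant of `V + e ⊗ S`. -/
def pertDet (V : E →L[ℂ] E) (S : E →L[ℂ] ℂ) (e : E) (z : ℂ) : ℂ := 1 - z * S (resN V z e)

theorem differentiable_pertDet : Differentiable ℂ (pertDet V S e) :=
  (differentiable_const 1).sub (differentiable_id.mul (differentiable_clm_resN_apply hV S e))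

omit hV in
/-- The convolution of an exponential `(1 - a V)⁻¹ e` with `g`. -/
def expConv (V : E →L[ℂ] E) (S : E →L[ℂ] ℂ) (e : E) (a : ℂ) (g : E) : E :=
  pertDet V S e a • resN V a (V g) + S (resN V a g) • resN V a e

omit [CompleteSpace E] in
-- The resolvent identity is applied to `g` and to `e`. The remainder is a multiple of the
-- determinant at `z`, so the transform is multiplicative modulo it.
theorem clm_resN_expConv {a z : ℂ} (h : z ≠ a) (g : E) :
    S (resN V z (expConv V S e a g)) = S (resN V z (resN V a e)) * S (resN V z g) +
      pertDet V S e z * ((a - z)⁻¹ * (S (resN V a g) - S (resN V z g))) := by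
  have h0 : a - z ≠ 0 := sub_ne_zero.2 h.symm
  have h1 := congrArg S (smul_resN_resN_apply hV a z g)
  have h2 := congrArg S (smul_resN_resN_apply hV a z e)
  have h3 := congrArg (fun y => S (resN V z y)) (resN_eq_add' hV a e)
  simp only [map_smul, map_sub, map_add, smul_eq_mul] at h1 h2 h3
  have h4 : (a - z) * S (resN V z (resN V a e)) = a * S (resN V a e) - z * S (resN V z e) := by
    rw [h3]; linear_combination a * h2
  simp only [expConv, map_add, map_smul, smul_eq_mul, pertDet]
  have h1' : S (resN V z (resN V a (V g))) = (a - z)⁻¹ * (S (resN V a g) - S (resN V z g)) := by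
    rw [← h1, inv_mul_cancel_left₀ h0]
  have h4' : S (resN V z (resN V a e)) =
      (a - z)⁻¹ * (a * S (resN V a e) - z * S (resN V z e)) := by
    rw [← h4, inv_mul_cancel_left₀ h0]
  rw [h1', h4']
  ring

/-- Since `a ≠ w`, the factor multiplying the determinant in `clm_resN_expConv` is smooth at `w`;
the determinant vanishes to order `m` there, so the remainder has no Taylor coefficients below `m`.
-/
theorem coefFun_expConv {a w : ℂ} (haw : a ≠ w) {m : ℕ}
    (hm : ∀ i < m, iteratedDeriv i (pertDet V S e) w = 0) (g : E) {k : ℕ} (hk : k < m) :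
    coefFun V S w k (expConv V S e a g) =
      ∑ p ∈ Finset.HasAntidiagonal.antidiagonal k, coefFun V S w p.1 (resN V a e) * coefFun V S w p.2 g := by
  have hA : ∀ (f : ℂ → ℂ), Differentiable ℂ f → ContDiffAt ℂ k f w := fun f hf =>
    hf.contDiff.contDiffAt
  have hρ : ContDiffAt ℂ k (fun z => (a - z)⁻¹ * (S (resN V a g) - S (resN V z g))) w := by
    refine ContDiffAt.mul ?_ (hA _ ((differentiable_const _).sub
      (differentiable_clm_resN_apply hV S g)))
    exact (contDiffAt_const.sub contDiffAt_id).inv (sub_ne_zero.2 haw)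
  rw [← taylorCoef_clm_resN hV]
  have hev : (fun z => S (resN V z (expConv V S e a g))) =ᶠ[𝓝 w] fun z =>
      S (resN V z (resN V a e)) • S (resN V z g) +
      pertDet V S e z • ((a - z)⁻¹ * (S (resN V a g) - S (resN V z g))) := by
    filter_upwards [isOpen_ne.mem_nhds haw.symm] with z hz
    exact clm_resN_expConv hV S e hz g
  have d1 := hA _ (differentiable_clm_resN_apply hV S (resN V a e))
  have d2 := hA _ (differentiable_clm_resN_apply hV S g)
  have d3 := hA _ (differentiable_pertDet hV S e)
  have d12 : ContDiffAt ℂ k (fun z => S (resN V z (resN V a e)) • S (resN V z g)) w := d1.smul d2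
  have d3ρ : ContDiffAt ℂ k (fun z => pertDet V S e z •
      ((a - z)⁻¹ * (S (resN V a g) - S (resN V z g)))) w := d3.smul hρ
  rw [taylorCoef_congr hev, taylorCoef_add d12 d3ρ, taylorCoef_smul d1 d2, taylorCoef_smul d3 hρ]
  rw [Finset.sum_eq_zero (s := Finset.HasAntidiagonal.antidiagonal k) (f := fun p =>
    taylorCoef p.1 (pertDet V S e) w •
      taylorCoef p.2 (fun z => (a - z)⁻¹ * (S (resN V a g) - S (resN V z g))) w), add_zero]
  · simp only [taylorCoef_clm_resN hV, smul_eq_mul]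
  · intro p hp
    have : p.1 < m := by
      have := Finset.HasAntidiagonal.mem_antidiagonal.1 hp
      omega
    rw [taylorCoef, hm _ this, smul_zero, zero_smul]

/-- A functional vanishing on all `(1, a (1 - a V)⁻¹ e)` vanishes on `(1, 0)` and all
`(0, Vⁿ e)`. -/
theorem eq_zero_of_forall_resN {w : ℂ} (hw : w ≠ 0) (α : ℂ) (l : E →L[ℂ] ℂ)
    (h : ∀ a ≠ w, α + l (a • resN V a e) = 0) : α = 0 ∧ ∀ n : ℕ, l ((V ^ n) e) = 0 := by
  -- The value `a = 0` is admissible because `w ≠ 0`.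
  have h0 : α = 0 := by simpa using h 0 hw.symm
  have hne : ∀ᶠ a : ℂ in 𝓝[≠] 0, a ≠ w := by
    filter_upwards [mem_nhdsWithin_of_mem_nhds (isOpen_ne.mem_nhds hw.symm)] with a ha using ha
  -- Dividing by `a` starts the induction. Then `R(a) x = x + a R(a) V x`: the term `l x` is the
  -- limit as `a → 0`, hence zero, and a further division by `a` replaces `x` by `V x`.
  have key : ∀ n : ℕ, ∀ᶠ a : ℂ in 𝓝[≠] 0, l (resN V a ((V ^ n) e)) = 0 := by
    have lim : ∀ x : E, (∀ᶠ a : ℂ in 𝓝[≠] 0, l (resN V a x) = 0) → l x = 0 := by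
      intro x hx
      have hc : Tendsto (fun a : ℂ => l (resN V a x)) (𝓝[≠] 0) (𝓝 (l (resN V 0 x))) :=
        ((differentiable_clm_resN_apply hV l x).continuous.tendsto 0).mono_left nhdsWithin_le_nhds
      rw [resN_zero V] at hc
      exact tendsto_nhds_unique hc (tendsto_const_nhds.congr' (hx.mono fun a ha => ha.symm))
    intro n
    induction n with
    | zero =>
      filter_upwards [hne, self_mem_nhdsWithin] with a ha ha0
      have := h a ha
      rw [h0, zero_add, map_smul, smul_eq_mul] at this
      exact (mul_eq_zero.1 this).resolve_left ha0
    | succ n ih =>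
      have hl := lim _ ih
      filter_upwards [ih, self_mem_nhdsWithin] with a ha ha0
      rw [resN_eq_add' hV, map_add, hl, zero_add, map_smul, smul_eq_mul] at ha
      rw [pow_succ']
      exact (mul_eq_zero.1 ha).resolve_left ha0
  refine ⟨h0, fun n => ?_⟩
  have hc : Tendsto (fun a : ℂ => l (resN V a ((V ^ n) e))) (𝓝[≠] 0)
      (𝓝 (l (resN V 0 ((V ^ n) e)))) :=
    ((differentiable_clm_resN_apply hV l _).continuous.tendsto 0).mono_left nhdsWithin_le_nhds
  rw [resN_zero V] at hc
  exact tendsto_nhds_unique hc (tendsto_const_nhds.congr' ((key n).mono fun a ha => ha.symm))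

end Perturbation

/-! ### Principal parts -/

/-- The extension of `(z - w)^m / F(z)` over a zero `w` of multiplicity `m`. -/
theorem exists_regularized_inv {F : ℂ → ℂ} {w : ℂ} (hF : AnalyticAt ℂ F w)
    (h : analyticOrderAt F w ≠ ⊤) :
    ∃ q : ℂ → ℂ, (∀ z, z ≠ w → q z = (z - w) ^ analyticOrderNatAt F w / F z) ∧
      AnalyticAt ℂ q w ∧ q w ≠ 0 := by
  obtain ⟨g, hg, hg0, hgF⟩ := hF.analyticOrderAt_ne_top.1 h
  refine ⟨Function.update (fun z => (z - w) ^ analyticOrderNatAt F w / F z) w (g w)⁻¹,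
    fun z hz => Function.update_of_ne hz _ _, ?_, ?_⟩
  · refine (hg.inv hg0).congr ?_
    filter_upwards [hgF] with z hz
    rcases eq_or_ne z w with rfl | hzw
    · simp
    · rw [Function.update_of_ne hzw, hz, smul_eq_mul, Pi.inv_apply,
        div_mul_eq_div_div, div_self (pow_ne_zero _ (sub_ne_zero.2 hzw)), one_div]
  · simpa using hg0

/-- Iterated derivatives are local, so off `w` those of `f` and of its extension `q` coincide, and
the latter are continuous at `w`. The limit avoids the quotient at `w` itself, where division by
zero gives an irrelevant value. -/
theorem limUnder_iteratedDeriv_eq {f q : ℂ → ℂ} {w : ℂ} (hq : AnalyticAt ℂ q w)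
    (h : ∀ z, z ≠ w → q z = f z) (j : ℕ) :
    limUnder (𝓝[≠] w) (fun z => iteratedDeriv j f z) = iteratedDeriv j q w := by
  refine Tendsto.limUnder_eq ?_
  have hc : ContinuousAt (iteratedDeriv j q) w := by
    rw [iteratedDeriv_eq_iterate]
    exact (hq.iterated_deriv j).continuousAt
  refine (hc.tendsto.mono_left nhdsWithin_le_nhds).congr' ?_
  filter_upwards [self_mem_nhdsWithin] with z hz
  refine EventuallyEq.iteratedDeriv_eq j ?_
  filter_upwards [isOpen_ne.mem_nhds hz] with y hy using h y hy

/-- The residue at `w` of a function with a pole of order `m`. -/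
theorem circleIntegral_div_pow_smul {F : Type*} [NormedAddCommGroup F] [NormedSpace ℂ F]
    [CompleteSpace F] {Ψ : ℂ → F} {w : ℂ} {δ : ℝ} (hδ : 0 < δ)
    (hΨ : DifferentiableOn ℂ Ψ (Metric.closedBall w δ)) (n : ℕ) :
    ((2 * (Real.pi : ℂ) * Complex.I)⁻¹) • ∮ z in C(w, δ), (1 / (z - w) ^ (n + 1)) • Ψ z =
      taylorCoef n Ψ w := by
  rw [hΨ.circleIntegral_one_div_sub_center_pow_smul hδ, smul_smul, taylorCoef]
  congr 1
  rw [div_eq_mul_inv, inv_mul_cancel_left₀ Complex.two_pi_I_ne_zero]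

/-! ### Resolvent and residues of the inverse of a rank one perturbation -/

section Perturbation

variable {E : Type*} [NormedAddCommGroup E] [NormedSpace ℂ E]
variable {V : E →L[ℂ] E} (hV : ∀ z : ℂ, IsUnit (1 - z • V)) (S : E →L[ℂ] ℂ) (e : E)

/-- The resolvent of the inverse of `V + e ⊗ S`. -/
def pertResolvent (V : E →L[ℂ] E) (S : E →L[ℂ] ℂ) (e : E) (z : ℂ) : E →L[ℂ] E :=
  V ∘L resN V z + ((pertDet V S e z)⁻¹ • (S ∘L resN V z)).smulRight (resN V z e)

theorem pertResolvent_apply (z : ℂ) (x : E) : pertResolvent V S e z x =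
    V (resN V z x) + ((pertDet V S e z)⁻¹ * S (resN V z x)) • resN V z e := rfl

theorem pertDet_zero : pertDet V S e 0 = 1 := by simp [pertDet]

include hV

omit hV in
theorem smul_clm_resN (z : ℂ) : z * S (resN V z e) = 1 - pertDet V S e z := by
  simp [pertDet]

theorem smul_V_resN (z : ℂ) (x : E) : z • V (resN V z x) = resN V z x - x := by
  nth_rewrite 2 [resN_eq_add hV]
  abel

/-- `pertResolvent` is a right inverse. -/
theorem pert_apply_pertResolvent {z : ℂ} (hz : pertDet V S e z ≠ 0) (f : E) :
    V (z • pertResolvent V S e z f + f) + S (z • pertResolvent V S e z f + f) • e =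
      pertResolvent V S e z f := by
  have h1 := smul_V_resN hV z f
  have h2 := smul_V_resN hV z e
  set c := (pertDet V S e z)⁻¹ * S (resN V z f) with hc
  have h3 : z • pertResolvent V S e z f + f = resN V z f + (c * z) • resN V z e := by
    rw [pertResolvent_apply, smul_add, h1, smul_smul, ← hc, mul_comm z c]
    abel
  have h4 : S (resN V z f) + c * z * S (resN V z e) = c := by
    rw [mul_assoc, smul_clm_resN, hc]
    field_simp
    ring
  rw [h3, map_add, map_add, map_smul, map_smul, smul_eq_mul, h4, mul_smul, h2,
    pertResolvent_apply, ← hc, smul_sub]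
  abel

/-- `pertResolvent` is a left inverse. -/
theorem pertResolvent_apply_pert {z : ℂ} (hz : pertDet V S e z ≠ 0) (h : E) :
    pertResolvent V S e z (h - z • (V h + S h • e)) = V h + S h • e := by
  have h1 : resN V z (h - z • (V h + S h • e)) = h - (z * S h) • resN V z e := by
    rw [smul_add, ← sub_sub, map_sub, resN_sub_smul hV, smul_smul, map_smul]
  have h2 := smul_V_resN hV z e
  have h3 : (pertDet V S e z)⁻¹ * (S h - z * S h * S (resN V z e)) = S h := by
    have : S h - z * S h * S (resN V z e) = pertDet V S e z * S h := by
      simp only [pertDet]; ring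
    rw [this, inv_mul_cancel_left₀ hz]
  rw [pertResolvent_apply, h1, map_sub, map_sub, map_smul, map_smul, smul_eq_mul, h3,
    mul_comm z, mul_smul, h2, smul_sub]
  abel

/-- This makes `R(z) e` an eigenvector of the inverse of `V + e ⊗ S` at each zero of the
determinant. -/
theorem pert_apply_eigenvector {z : ℂ} (hz : pertDet V S e z = 0) :
    V (z • resN V z e) + S (z • resN V z e) • e = resN V z e := by
  rw [map_smul, smul_V_resN hV, map_smul, smul_eq_mul, smul_clm_resN, hz, sub_zero, one_smul]
  abel

variable [CompleteSpace E]

/-- The determinant equals `1` at `0`, so by the identity theorem it vanishes identically near no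
point; its zeros are isolated and of finite multiplicity. -/
theorem analyticOrderAt_pertDet_ne_top (w : ℂ) : analyticOrderAt (pertDet V S e) w ≠ ⊤ := by
  intro h
  have hA : AnalyticOnNhd ℂ (pertDet V S e) univ := fun z _ =>
    (differentiable_pertDet hV S e).analyticAt z
  have := hA.eqOn_zero_of_preconnected_of_eventuallyEq_zero isPreconnected_univ (mem_univ w)
    (analyticOrderAt_eq_top.1 h) (mem_univ 0)
  rw [pertDet_zero] at this
  exact one_ne_zero this

theorem iteratedDeriv_pertDet_eq_zero (w : ℂ) :
    ∀ i < analyticOrderNatAt (pertDet V S e) w, iteratedDeriv i (pertDet V S e) w = 0 := by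
  rw [← natCast_le_analyticOrderAt_iff_iteratedDeriv_eq_zero
    ((differentiable_pertDet hV S e).analyticAt w),
    Nat.cast_analyticOrderNatAt (analyticOrderAt_pertDet_ne_top hV S e w)]

theorem analyticOrderNatAt_pertDet_pos {w : ℂ} (hw : pertDet V S e w = 0) :
    0 < analyticOrderNatAt (pertDet V S e) w := by
  refine Nat.pos_of_ne_zero fun h => ?_
  have h1 := Nat.cast_analyticOrderNatAt (analyticOrderAt_pertDet_ne_top hV S e w)
  rw [h, Nat.cast_zero] at h1
  exact (((differentiable_pertDet hV S e).analyticAt w).analyticOrderAt_eq_zero.1 h1.symm) hw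

theorem exists_pertDet_ne_zero (w : ℂ) :
    ∃ δ : ℝ, 0 < δ ∧ ∀ z ∈ Metric.closedBall w δ, pertDet V S e z = 0 → z = w := by
  have hA := (differentiable_pertDet hV S e).analyticAt w
  rcases hA.eventually_eq_zero_or_eventually_ne_zero with h | h
  · exact absurd (analyticOrderAt_eq_top.2 h) (analyticOrderAt_pertDet_ne_top hV S e w)
  · rw [eventually_nhdsWithin_iff] at h
    obtain ⟨ε, hε, hb⟩ := Metric.nhds_basis_closedBall.eventually_iff.1 h
    exact ⟨ε, hε, fun z hz h0 => by_contra fun hne => hb hz hne h0⟩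

/-- The Riesz projection of the rank one perturbation. -/
theorem circleIntegral_pertResolvent {w : ℂ} {δ : ℝ} (hδ : 0 < δ)
    (hD : ∀ z ∈ Metric.closedBall w δ, pertDet V S e z = 0 → z = w) {q : ℂ → ℂ} {n : ℕ}
    (hq : ∀ z, z ≠ w → q z = (z - w) ^ (n + 1) / pertDet V S e z) (hqa : AnalyticAt ℂ q w)
    (f : E) :
    ((2 * (Real.pi : ℂ) * Complex.I)⁻¹) • ∮ z in C(w, δ), pertResolvent V S e z f =
      ∑ p ∈ Finset.HasAntidiagonal.antidiagonal n, coefFun V S w p.1 f •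
        ∑ r ∈ Finset.HasAntidiagonal.antidiagonal p.2,
          taylorCoef r.1 q w • (V ^ r.2 * resN V w ^ (r.2 + 1)) e := by
  have d1 := differentiable_clm_resN_apply hV S f
  have d2 := differentiable_resN_apply hV e
  have d3 := differentiable_resN_apply hV f
  have hqd : DifferentiableOn ℂ q (Metric.closedBall w δ) := by
    intro z hz
    rcases eq_or_ne z w with rfl | hzw
    · exact hqa.differentiableAt.differentiableWithinAt
    · have : DifferentiableAt ℂ (fun z => (z - w) ^ (n + 1) / pertDet V S e z) z :=
        ((differentiableAt_id.sub_const w).pow _).div (differentiable_pertDet hV S e z)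
          (fun h => hzw (hD z hz h))
      refine (this.congr_of_eventuallyEq ?_).differentiableWithinAt
      filter_upwards [isOpen_ne.mem_nhds hzw] with y hy using hq y hy
  -- Here `n + 1` is the exponent clearing the zero of the determinant: the singular term is `(z -
  -- w)^(-(n+1)) Ψ(z)` with `Ψ` holomorphic across `w`, and its residue is the `n`-th Taylor
  -- coefficient of `Ψ`. The other term is entire and integrates to zero.
  set Ψ : ℂ → E := fun z => S (resN V z f) • q z • resN V z e with hΨ
  have hΨd : DifferentiableOn ℂ Ψ (Metric.closedBall w δ) :=
    d1.differentiableOn.smul (hqd.smul d2.differentiableOn)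
  have hne : ∀ z ∈ Metric.sphere w δ, z ≠ w := fun z hz h => by
    rw [h, Metric.mem_sphere, dist_self] at hz
    exact hδ.ne hz
  have hsplit : (∮ z in C(w, δ), pertResolvent V S e z f) =
      (∮ z in C(w, δ), V (resN V z f)) + ∮ z in C(w, δ), (1 / (z - w) ^ (n + 1)) • Ψ z := by
    rw [← circleIntegral.integral_add]
    · refine circleIntegral.integral_congr hδ.le fun z hz => ?_
      have h0 : (z - w) ^ (n + 1) ≠ 0 := pow_ne_zero _ (sub_ne_zero.2 (hne z hz))
      simp only [pertResolvent_apply, hΨ, hq z (hne z hz), smul_smul]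
      congr 2
      field_simp
    · exact ((V.continuous.comp d3.continuous).continuousOn).circleIntegrable hδ.le
    · refine ContinuousOn.circleIntegrable hδ.le ?_
      refine ContinuousOn.smul (f := fun z => 1 / (z - w) ^ (n + 1)) ?_
        (hΨd.continuousOn.mono Metric.sphere_subset_closedBall)
      exact continuousOn_const.div (by fun_prop)
        fun z hz => pow_ne_zero _ (sub_ne_zero.2 (hne z hz))
  have hz : (∮ z in C(w, δ), V (resN V z f)) = 0 :=
    DiffContOnCl.circleIntegral_eq_zero hδ.le
      (V.differentiable.comp d3).diffContOnCl
  rw [hsplit, hz, zero_add, circleIntegral_div_pow_smul hδ hΨd]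
  have c2 : ∀ k : ℕ, ContDiffAt ℂ k (fun z => resN V z e) w := fun k => d2.contDiff.contDiffAt
  have cq : ∀ k : ℕ, ContDiffAt ℂ k q w := fun k => hqa.contDiffAt
  have cqe : ContDiffAt ℂ n (fun z => q z • resN V z e) w := (cq n).smul (c2 n)
  rw [hΨ, taylorCoef_smul d1.contDiff.contDiffAt cqe]
  refine Finset.sum_congr rfl fun p _ => ?_
  rw [taylorCoef_clm_resN hV, taylorCoef_smul (cq _) (c2 _)]
  simp only [taylorCoef_resN hV]

end Perturbation

/-! ### The Volterra operator -/

/-- The function `i ∫₀ˣ h`. -/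
def primFn (h : ℝ → ℂ) (x : ℝ) : ℂ := Complex.I * ∫ t in (0 : ℝ)..x, h t

theorem primFn_congr {b : ℝ} {h k : ℝ → ℂ} (hk : h =ᵐ[μI b] k) {x : ℝ} (hx : x ∈ Icc 0 b) :
    primFn h x = primFn k x := by
  rw [primFn, primFn, intervalIntegral.integral_of_le hx.1, intervalIntegral.integral_of_le hx.1]
  congr 1
  exact integral_congr_ae (ae_restrict_of_ae_restrict_of_subset (Ioc_subset_Ioc_right hx.2) hk)

theorem L2.intervalIntegrable_of_mem {b : ℝ} (h : L2 b) {x : ℝ} (hx : x ∈ Icc 0 b) :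
    IntervalIntegrable h volume 0 x :=
  (intervalIntegrable_iff_integrableOn_Ioc_of_le hx.1).2
    (IntegrableOn.mono_set (L2.integrable h) (Ioc_subset_Ioc_right hx.2))

theorem continuousOn_primFn {b : ℝ} (h : L2 b) : ContinuousOn (primFn h) (Icc 0 b) := by
  refine continuousOn_const.mul (continuousOn_of_primitive (h := h) fun x _ => ?_)
  simp

theorem memLp_primFn {b : ℝ} (h : L2 b) : MemLp (primFn h) 2 (μI b) :=
  memLp_of_continuousOn (continuousOn_primFn h)

theorem norm_integral_le_of_mem {b : ℝ} (h : L2 b) {x : ℝ} (hx : x ∈ Icc 0 b) :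
    ‖∫ t in (0 : ℝ)..x, h t‖ ≤ ∫ t, ‖h t‖ ∂(μI b) := by
  rw [intervalIntegral.integral_of_le hx.1]
  exact (norm_integral_le_integral_norm _).trans (setIntegral_mono_set (L2.integrable h).norm
    (Eventually.of_forall fun t => norm_nonneg _) (Ioc_subset_Ioc_right hx.2).eventuallyLE)

theorem norm_primFn_le {b : ℝ} (h : L2 b) {x : ℝ} (hx : x ∈ Icc 0 b) :
    ‖primFn h x‖ ≤ ∫ t, ‖h t‖ ∂(μI b) := by
  rw [primFn, norm_mul, Complex.norm_I, one_mul]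
  exact norm_integral_le_of_mem h hx

theorem exists_integral_norm_le (b : ℝ) :
    ∃ C : ℝ, 0 ≤ C ∧ ∀ h : L2 b, ∫ t, ‖h t‖ ∂(μI b) ≤ C * ‖h‖ := by
  refine ⟨((μI b univ) ^ (1 / (1 : ENNReal).toReal - 1 / (2 : ENNReal).toReal)).toReal,
    ENNReal.toReal_nonneg, fun h => ?_⟩
  have h1 := eLpNorm_le_eLpNorm_mul_rpow_measure_univ (μ := μI b) (p := 1) (q := 2)
    (by norm_num) (Lp.aestronglyMeasurable h)
  rw [integral_norm_eq_lintegral_enorm (Lp.aestronglyMeasurable h),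
    ← eLpNorm_one_eq_lintegral_enorm, mul_comm, Lp.norm_def, ← ENNReal.toReal_mul]
  refine ENNReal.toReal_mono (ENNReal.mul_ne_top (Lp.eLpNorm_ne_top h) ?_) h1
  refine (ENNReal.rpow_lt_top_of_nonneg ?_ (measure_ne_top _ _)).ne
  norm_num

theorem exists_norm_le_of_ae_bound (b : ℝ) :
    ∃ C : ℝ, 0 ≤ C ∧ ∀ (h : L2 b) (D : ℝ), 0 ≤ D → (∀ᵐ x ∂(μI b), ‖h x‖ ≤ D) → ‖h‖ ≤ C * D :=
  ⟨(measureUnivNNReal (μI b) : ℝ) ^ (ENNReal.toReal 2)⁻¹, by positivity,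
    fun _ _ hD hh => Lp.norm_le_of_ae_bound hD hh⟩

/-- The Volterra operator `h ↦ i ∫₀ˣ h` in `L₂(0,b)`. -/
def volt (b : ℝ) : L2 b →L[ℂ] L2 b :=
  LinearMap.mkContinuousOfExistsBound
    { toFun := fun h => (memLp_primFn h).toLp (primFn h)
      map_add' := by
        intro h k
        refine Eq.trans ?_ (MemLp.toLp_add _ _)
        refine (MemLp.toLp_eq_toLp_iff _ _).2 ?_
        filter_upwards [ae_mem_Ioo b] with x hx
        have hx' := Ioo_subset_Icc_self hx
        rw [primFn_congr (Lp.coeFn_add h k) hx', Pi.add_apply, primFn, primFn, primFn, ← mul_add]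
        congr 1
        exact intervalIntegral.integral_add (L2.intervalIntegrable_of_mem h hx')
          (L2.intervalIntegrable_of_mem k hx')
      map_smul' := by
        intro c h
        refine Eq.trans ?_ (MemLp.toLp_const_smul c _)
        refine (MemLp.toLp_eq_toLp_iff _ _).2 ?_
        filter_upwards [ae_mem_Ioo b] with x hx
        have hx' := Ioo_subset_Icc_self hx
        rw [primFn_congr (Lp.coeFn_smul c h) hx', Pi.smul_apply, primFn, primFn]
        simp only [Pi.smul_apply, smul_eq_mul, intervalIntegral.integral_const_mul]
        ring }
    (by
      obtain ⟨C, hC, h1⟩ := exists_integral_norm_le b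
      obtain ⟨D, hD, h2⟩ := exists_norm_le_of_ae_bound b
      refine ⟨D * C, fun h => ?_⟩
      refine (h2 _ _ (integral_nonneg fun t => norm_nonneg (h t)) ?_).trans
        ((mul_le_mul_of_nonneg_left (h1 h) hD).trans_eq (mul_assoc _ _ _).symm)
      filter_upwards [ae_mem_Ioo b, (memLp_primFn h).coeFn_toLp] with x hx hx'
      change ‖((memLp_primFn h).toLp (primFn h)) x‖ ≤ _
      rw [hx']
      exact norm_primFn_le h (Ioo_subset_Icc_self hx))

theorem volt_ae {b : ℝ} (h : L2 b) : volt b h =ᵐ[μI b] primFn h := (memLp_primFn h).coeFn_toLp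

theorem volt_toLp_ae {b : ℝ} {φ : ℝ → ℂ} (hφ : MemLp φ 2 (μI b)) :
    volt b (hφ.toLp φ) =ᵐ[μI b] primFn φ := by
  filter_upwards [volt_ae (hφ.toLp φ), ae_mem_Ioo b] with x hx hx'
  rw [hx, primFn_congr hφ.coeFn_toLp (Ioo_subset_Icc_self hx')]

theorem volt_toLp {b : ℝ} {φ ψ : ℝ → ℂ} (hφ : MemLp φ 2 (μI b)) (hψ : MemLp ψ 2 (μI b))
    (h : ∀ x ∈ Ioo 0 b, primFn φ x = ψ x) : volt b (hφ.toLp φ) = hψ.toLp ψ := by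
  refine Lp.ext ?_
  filter_upwards [volt_toLp_ae hφ, hψ.coeFn_toLp, ae_mem_Ioo b] with x h1 h2 h3
  rw [h1, h2, h x h3]

/-- The first integration turns the `L¹` norm into a uniform bound; each later one raises the power
of `x` and divides by the new exponent. Hence `n + 1` factors against `xⁿ / n!`. -/
theorem norm_volt_pow_ae {b : ℝ} (h : L2 b) (n : ℕ) : ∀ᵐ x ∂(μI b),
    ‖((volt b) ^ (n + 1)) h x‖ ≤ (∫ t, ‖h t‖ ∂(μI b)) * (x ^ n / n.factorial) := by
  induction n with
  | zero =>
    filter_upwards [volt_ae h, ae_mem_Ioo b] with x hx hx'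
    rw [zero_add, pow_one, hx]
    simpa using norm_primFn_le h (Ioo_subset_Icc_self hx')
  | succ n ih =>
    set M := ∫ t, ‖h t‖ ∂(μI b)
    filter_upwards [volt_ae (((volt b) ^ (n + 1)) h), ae_mem_Ioo b] with x hx hx'
    rw [pow_succ', mul_apply_eq_comp, hx, primFn, norm_mul, Complex.norm_I, one_mul]
    have hint : ∫ t in (0 : ℝ)..x, M * (t ^ n / n.factorial) =
        M * (x ^ (n + 1) / (n + 1).factorial) := by
      rw [intervalIntegral.integral_const_mul, intervalIntegral.integral_div, integral_pow,
        Nat.factorial_succ, Nat.cast_mul]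
      simp only [ne_eq, Nat.add_eq_zero_iff, one_ne_zero, and_false, not_false_eq_true, zero_pow,
        sub_zero, Nat.cast_add, Nat.cast_one]
      rw [div_div]
    rw [← hint]
    refine intervalIntegral.norm_integral_le_of_norm_le hx'.1.le ?_ ?_
    · rw [← ae_restrict_iff' measurableSet_Ioc]
      exact ae_restrict_of_ae_restrict_of_subset (Ioc_subset_Ioc_right hx'.2.le) ih
    · exact (by fun_prop : Continuous fun t : ℝ => M * (t ^ n / n.factorial)).intervalIntegrable _ _

/-- Factorial decay makes some power of `T = zV` a strict contraction, so `1 - T^(n+1)` is a unit;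
it is the product of `1 - T` and a commuting geometric sum, so both factors are units. -/
theorem isUnit_one_sub_smul_volt {b : ℝ} (z : ℂ) : IsUnit (1 - z • volt b) := by
  obtain ⟨C, hC, h1⟩ := exists_integral_norm_le b
  obtain ⟨D, hD, h2⟩ := exists_norm_le_of_ae_bound b
  have hpow : ∀ n : ℕ, ‖(z • volt b) ^ (n + 1)‖ ≤
      ‖z‖ * (D * C) * ((‖z‖ * |b|) ^ n / n.factorial) := by
    intro n
    have hb : ∀ h : L2 b, ‖((volt b) ^ (n + 1)) h‖ ≤ D * C * (|b| ^ n / n.factorial) * ‖h‖ := by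
      intro h
      have hM : 0 ≤ ∫ t, ‖h t‖ ∂(μI b) := integral_nonneg fun t => norm_nonneg (h t)
      refine (h2 _ ((∫ t, ‖h t‖ ∂(μI b)) * (|b| ^ n / n.factorial)) (by positivity) ?_).trans ?_
      · filter_upwards [norm_volt_pow_ae h n, ae_mem_Ioo b] with x hx hx'
        refine hx.trans (mul_le_mul_of_nonneg_left ?_ hM)
        have : x ≤ |b| := hx'.2.le.trans (le_abs_self b)
        have := hx'.1.le
        gcongr
      · have := mul_le_mul_of_nonneg_left (h1 h)
          (by positivity : 0 ≤ D * (|b| ^ n / n.factorial))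
        linarith
    have hn := ContinuousLinearMap.opNorm_le_bound _ (by positivity) hb
    rw [smul_pow, norm_smul, norm_pow]
    refine (mul_le_mul_of_nonneg_left hn (by positivity)).trans_eq ?_
    rw [mul_pow]
    ring
  have hlim : Tendsto (fun n : ℕ => ‖z‖ * (D * C) * ((‖z‖ * |b|) ^ n / n.factorial)) atTop
      (𝓝 0) := by
    simpa using (FloorSemiring.tendsto_pow_div_factorial_atTop (‖z‖ * |b|)).const_mul
      (‖z‖ * (D * C))
  obtain ⟨n, hn⟩ := (hlim.eventually (gt_mem_nhds one_pos)).exists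
  have hu : IsUnit (1 - (z • volt b) ^ (n + 1)) :=
    isUnit_one_sub_of_norm_lt_one ((hpow n).trans_lt hn)
  have hc : Commute (∑ i ∈ Finset.range (n + 1), (z • volt b) ^ i) (1 - z • volt b) := by
    rw [commute_iff_eq, geom_sum_mul_neg, mul_neg_geom_sum]
  rw [← geom_sum_mul_neg] at hu
  exact (hc.isUnit_mul_iff.1 hu).2

/-! ### Exponentials and the boundary functional -/

theorem memLp_of_continuous {b : ℝ} {f : ℝ → ℂ} (hf : Continuous f) : MemLp f 2 (μI b) :=
  memLp_of_continuousOn hf.continuousOn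

/-- The class of a continuous function. -/
def ofCont (b : ℝ) (f : ℝ → ℂ) (hf : Continuous f) : L2 b := (memLp_of_continuous hf).toLp f

theorem ofCont_ae {b : ℝ} {f : ℝ → ℂ} (hf : Continuous f) : ofCont b f hf =ᵐ[μI b] f :=
  (memLp_of_continuous hf).coeFn_toLp

/-- The constant function `1`. -/
def oneL (b : ℝ) : L2 b := ofCont b (fun _ => 1) continuous_const

/-- The root functions of `-i d/dx`, without boundary conditions. -/
def expMon (w : ℂ) (n : ℕ) (x : ℝ) : ℂ :=
  (Complex.I * x) ^ n / n.factorial * Complex.exp (Complex.I * w * x)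

theorem continuous_expMon (w : ℂ) (n : ℕ) : Continuous (expMon w n) := by
  unfold expMon; fun_prop

theorem hasDerivAt_expMon_zero (w : ℂ) (x : ℝ) :
    HasDerivAt (expMon w 0) (Complex.I * w * expMon w 0 x) x := by
  have h := (((hasDerivAt_id x).ofReal_comp).const_mul (Complex.I * w)).cexp
  simp only [id, mul_one, Complex.ofReal_one] at h
  have e : expMon w 0 = fun x : ℝ => Complex.exp (Complex.I * w * x) := by
    funext y; simp [expMon]
  rw [e]
  exact h.congr_deriv (mul_comm _ _)

theorem hasDerivAt_expMon_succ (w : ℂ) (n : ℕ) (x : ℝ) :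
    HasDerivAt (expMon w (n + 1)) (Complex.I * expMon w n x + Complex.I * w * expMon w (n + 1) x)
      x := by
  have h1 := (((hasDerivAt_id x).ofReal_comp).const_mul (Complex.I * w)).cexp
  have h2 := ((((hasDerivAt_id x).ofReal_comp).const_mul Complex.I).pow (n + 1)).div_const
    ((n + 1).factorial : ℂ)
  have h := h2.mul h1
  refine h.congr_deriv ?_
  have hf : (n.factorial : ℂ) ≠ 0 := Nat.cast_ne_zero.2 n.factorial_ne_zero
  have hn : ((n : ℂ) + 1) ≠ 0 := Nat.cast_add_one_ne_zero n
  simp only [expMon, id, mul_one, Complex.ofReal_one, Nat.factorial_succ, Nat.cast_mul,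
    Nat.cast_add, Nat.cast_one, Nat.add_sub_cancel, Pi.pow_apply]
  field_simp

theorem primFn_eq_of_hasDerivAt {φ φ' : ℝ → ℂ} (hφ : ∀ x, HasDerivAt φ (Complex.I * φ' x) x)
    (hc : Continuous φ') (x : ℝ) : primFn φ' x = φ x - φ 0 := by
  rw [primFn, ← intervalIntegral.integral_const_mul,
    intervalIntegral.integral_eq_sub_of_hasDerivAt (fun y _ => hφ y)
      ((continuous_const.mul hc).intervalIntegrable _ _)]

theorem volt_ofCont {b : ℝ} {φ ψ : ℝ → ℂ} (hφ : Continuous φ) (hψ : Continuous ψ)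
    (h : ∀ x ∈ Ioo 0 b, primFn φ x = ψ x) : volt b (ofCont b φ hφ) = ofCont b ψ hψ :=
  volt_toLp _ _ h

/-- Integrating `y' = iwy`, `y(0) = 1`, gives `y - wVy = 1`, which determines `y`. -/
theorem resN_volt_oneL {b : ℝ} (w : ℂ) :
    resN (volt b) w (oneL b) = ofCont b (expMon w 0) (continuous_expMon w 0) := by
  symm
  refine eq_resN_of_sub isUnit_one_sub_smul_volt ?_
  have hv : volt b (w • ofCont b (expMon w 0) (continuous_expMon w 0)) =
      ofCont b (fun x => expMon w 0 x - 1) ((continuous_expMon w 0).sub continuous_const) := by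
    refine volt_ofCont ((continuous_expMon w 0).const_smul w) _ fun x _ => ?_
    refine (primFn_eq_of_hasDerivAt (φ := expMon w 0) (fun y => ?_)
      ((continuous_expMon w 0).const_smul w) x).trans ?_
    · refine (hasDerivAt_expMon_zero w y).congr_deriv ?_
      simp only [Pi.smul_apply, smul_eq_mul]; ring
    · simp [expMon]
  rw [← map_smul, hv]
  refine (MemLp.toLp_sub (memLp_of_continuous (continuous_expMon w 0)) _).symm.trans ?_
  refine (MemLp.toLp_eq_toLp_iff _ (memLp_of_continuous continuous_const)).2
    (Eventually.of_forall fun x => ?_)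
  simp

/-- These are the Taylor coefficients in `z` of `exp(izx)`. In the induction, `y = expMon w (n+1)`
satisfies `y - wVy = V (expMon w n)`, the integrated form of its differential equation with `y(0) =
0`. -/
theorem volt_pow_resN_oneL {b : ℝ} (w : ℂ) (n : ℕ) :
    ((volt b) ^ n * resN (volt b) w ^ (n + 1)) (oneL b) =
      ofCont b (expMon w n) (continuous_expMon w n) := by
  induction n with
  | zero => simpa using resN_volt_oneL w
  | succ n ih =>
    have hc := (commute_resN (isUnit_one_sub_smul_volt (b := b)) w)
    have e : (volt b) ^ (n + 1) * resN (volt b) w ^ (n + 1 + 1) =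
        resN (volt b) w * volt b * ((volt b) ^ n * resN (volt b) w ^ (n + 1)) := by
      rw [← hc.eq, mul_assoc, ← mul_assoc (resN (volt b) w), ← (hc.pow_left n).eq, mul_assoc,
        ← mul_assoc, ← pow_succ', ← pow_succ']
    rw [e, mul_apply_eq_comp, ih, mul_apply_eq_comp]
    symm
    refine eq_resN_of_sub isUnit_one_sub_smul_volt ?_
    rw [← map_smul, sub_eq_iff_eq_add, ← map_add]
    symm
    have hcont : Continuous (expMon w n + w • expMon w (n + 1)) :=
      (continuous_expMon w n).add ((continuous_expMon w (n + 1)).const_smul w)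
    refine volt_ofCont hcont _ fun x _ => ?_
    refine (primFn_eq_of_hasDerivAt (φ := expMon w (n + 1)) (fun y => ?_) hcont x).trans ?_
    · refine (hasDerivAt_expMon_succ w n y).congr_deriv ?_
      simp only [Pi.add_apply, Pi.smul_apply, smul_eq_mul]; ring
    · simp [expMon]

theorem volt_pow_oneL {b : ℝ} (n : ℕ) :
    ((volt b) ^ n) (oneL b) = ofCont b (expMon 0 n) (continuous_expMon 0 n) := by
  rw [← volt_pow_resN_oneL, resN_zero, one_pow, mul_one]

/-- The functional `f ↦ ∫₀ᵇ f conj σ`. -/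
def sigFun {b : ℝ} (σ : L2 b) : L2 b →L[ℂ] ℂ := innerSL ℂ σ

theorem sigFun_eq {b : ℝ} (hb : 0 ≤ b) (σ : L2 b) {f : L2 b} {φ : ℝ → ℂ} (h : f =ᵐ[μI b] φ) :
    sigFun σ f = ∫ x in (0 : ℝ)..b, φ x * (starRingEnd ℂ) (σ x) := by
  rw [sigFun, innerSL_apply_apply, L2.inner_def, intervalIntegral.integral_of_le hb]
  refine integral_congr_ae ?_
  filter_upwards [h] with x hx
  rw [hx]
  rfl

theorem charFn_eq_pertDet {b : ℝ} (hb : 0 ≤ b) (σ : L2 b) :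
    charFn b σ = pertDet (volt b) (sigFun σ) (oneL b) := by
  funext z
  rw [pertDet, resN_volt_oneL, sigFun_eq hb σ (ofCont_ae _), charFn]
  simp [expMon]

/-! ### The operator `L` as an inverse -/

theorem oneL_ae (b : ℝ) : oneL b =ᵐ[μI b] fun _ => 1 := ofCont_ae _

/-- The function `Y = i ∫₀ˣ h + S h` has `-iY' = h` and `Y(0) = S h`, which is exactly the boundary
condition. -/
theorem isDomRep_pert {b : ℝ} (hb : 0 < b) (σ h : L2 b) :
    ∃ hY : IsDomRep b σ (volt b h + sigFun σ h • oneL b) (fun x => primFn h x + sigFun σ h),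
      negIDeriv _ hY.1 = h := by
  have hY : ∀ x ∈ Icc 0 b, (fun x => primFn h x + sigFun σ h) x =
      (fun x => primFn h x + sigFun σ h) 0 + ∫ t in (0 : ℝ)..x, (Complex.I • h : L2 b) t := by
    intro x hx
    have e : primFn (Complex.I • h : L2 b) x = primFn (fun t => Complex.I * h t) x :=
      primFn_congr (Lp.coeFn_smul Complex.I h) hx
    simp only [primFn, intervalIntegral.integral_const_mul] at e ⊢
    rw [mul_left_cancel₀ Complex.I_ne_zero e]
    simp only [intervalIntegral.integral_same]
    ring
  have hW : IsW12 b (fun x => primFn h x + sigFun σ h) := ⟨_, hY⟩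
  have hd : ∀ᵐ x ∂(μI b), -Complex.I * deriv (fun x => primFn h x + sigFun σ h) x = h x := by
    filter_upwards [ae_hasDerivAt hY, Lp.coeFn_smul Complex.I h] with x h1 h2
    rw [h1.deriv, h2, Pi.smul_apply, smul_eq_mul, ← mul_assoc]
    simp
  refine ⟨⟨hW, ?_, ?_⟩, ?_⟩
  · have : ∫ x in (0 : ℝ)..b, (-Complex.I * deriv (fun x => primFn h x + sigFun σ h) x) *
        (starRingEnd ℂ) (σ x) = sigFun σ h := by
      refine Eq.trans ?_ (sigFun_eq hb.le σ (EventuallyEq.refl _ h)).symm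
      rw [intervalIntegral.integral_of_le hb.le, intervalIntegral.integral_of_le hb.le]
      refine integral_congr_ae ?_
      filter_upwards [hd] with x hx
      rw [hx]
    rw [bdry, this]
    simp [primFn]
  · filter_upwards [Lp.coeFn_add (volt b h) (sigFun σ h • oneL b), volt_ae h,
      Lp.coeFn_smul (sigFun σ h) (oneL b), oneL_ae b] with x h1 h2 h3 h4
    rw [h1, Pi.add_apply, h2, h3, Pi.smul_apply, h4, smul_eq_mul, mul_one]
  · refine Lp.ext ?_
    refine (MemLp.coeFn_toLp _).trans hd

theorem pert_mem_domain {b : ℝ} (hb : 0 < b) (σ h : L2 b) :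
    volt b h + sigFun σ h • oneL b ∈ (Lop b hb σ).domain := ⟨_, (isDomRep_pert hb σ h).choose⟩

theorem Lop_pert {b : ℝ} (hb : 0 < b) (σ h : L2 b) :
    Lop b hb σ ⟨_, pert_mem_domain hb σ h⟩ = h := by
  obtain ⟨hY, hh⟩ := isDomRep_pert hb σ h
  rw [Lop_apply hb σ ⟨_, pert_mem_domain hb σ h⟩ hY, hh]

theorem eq_primFn_of_isW12 {b : ℝ} {Y : ℝ → ℂ} (hY : IsW12 b Y) {x : ℝ} (hx : x ∈ Icc 0 b) :
    Y x = Y 0 + primFn (negIDeriv Y hY) x := by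
  obtain ⟨k, hk⟩ := id hY
  have e : negIDeriv Y hY =ᵐ[μI b] fun t => -Complex.I * k t := by
    refine (MemLp.coeFn_toLp _).trans ?_
    filter_upwards [ae_hasDerivAt hk] with x hx
    rw [hx.deriv]
  rw [hk x hx, primFn_congr e hx, primFn, intervalIntegral.integral_const_mul, ← mul_assoc]
  simp

/-- The condition `U(Y) = 0` recovers the integration constant as `Y(0) = S(L y)`, so `V + e ⊗ S` is
also a left inverse of `L`. -/
theorem pert_Lop {b : ℝ} (hb : 0 < b) (σ : L2 b) (y : (Lop b hb σ).domain) :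
    volt b (Lop b hb σ y) + sigFun σ (Lop b hb σ y) • oneL b = y := by
  obtain ⟨Y, hY⟩ := y.2
  rw [Lop_apply hb σ y hY]
  have h0 : sigFun σ (negIDeriv Y hY.1) = Y 0 := by
    rw [sigFun_eq hb.le σ (f := negIDeriv Y hY.1) (φ := fun x => -Complex.I * deriv Y x)
      (MemLp.coeFn_toLp _)]
    exact (sub_eq_zero.1 hY.2.1).symm
  refine Lp.ext ?_
  filter_upwards [Lp.coeFn_add (volt b (negIDeriv Y hY.1)) (sigFun σ (negIDeriv Y hY.1) • oneL b),
    volt_ae (negIDeriv Y hY.1), Lp.coeFn_smul (sigFun σ (negIDeriv Y hY.1)) (oneL b), oneL_ae b,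
    hY.2.2, ae_mem_Ioo b] with x h1 h2 h3 h4 h5 h6
  rw [h1, Pi.add_apply, h2, h3, Pi.smul_apply, h4, smul_eq_mul, mul_one, h0, h5,
    eq_primFn_of_isW12 hY.1 (Ioo_subset_Icc_self h6), add_comm]

theorem isResolvent_Lop {b : ℝ} (hb : 0 < b) (σ : L2 b) {z : ℂ}
    (hz : pertDet (volt b) (sigFun σ) (oneL b) z ≠ 0) :
    IsResolvent (Lop b hb σ) z (pertResolvent (volt b) (sigFun σ) (oneL b) z) := by
  refine ⟨fun f => ?_, fun y => ?_⟩
  · have h := pert_apply_pertResolvent isUnit_one_sub_smul_volt (sigFun σ) (oneL b) hz f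
    have h2 := pert_mem_domain hb σ (z • pertResolvent (volt b) (sigFun σ) (oneL b) z f + f)
    have h3 := Lop_pert hb σ (z • pertResolvent (volt b) (sigFun σ) (oneL b) z f + f)
    refine ⟨h ▸ h2, ?_⟩
    rw [sub_eq_iff_eq_add, add_comm f]
    exact (congrArg (Lop b hb σ) (Subtype.ext h.symm)).trans h3
  · have h := pertResolvent_apply_pert isUnit_one_sub_smul_volt (sigFun σ) (oneL b) hz
      (Lop b hb σ y)
    rwa [pert_Lop hb σ y] at h

theorem oneL_ne_zero {b : ℝ} (hb : 0 < b) : oneL b ≠ 0 := by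
  intro h
  have h1 : (fun _ : ℝ => (1 : ℂ)) =ᵐ[μI b] fun _ => 0 := by
    have := oneL_ae b
    rw [h] at this
    exact this.symm.trans (Lp.coeFn_zero ℂ 2 (μI b))
  have h2 : ∀ᵐ x ∂(μI b), False := by
    filter_upwards [h1] with x hx using one_ne_zero hx
  rw [eventually_false_iff_eq_bot, ae_eq_bot, Measure.restrict_eq_zero, Real.volume_Ioc,
    sub_zero, ENNReal.ofReal_eq_zero] at h2
  exact absurd h2 (not_le.2 hb)

theorem mem_spec_Lop {b : ℝ} (hb : 0 < b) (σ : L2 b) (z : ℂ) :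
    z ∈ spec (Lop b hb σ) ↔ pertDet (volt b) (sigFun σ) (oneL b) z = 0 := by
  refine ⟨fun h => by_contra fun hz => h ⟨_, isResolvent_Lop hb σ hz⟩, fun hz => ?_⟩
  rintro ⟨R, hR⟩
  -- The eigenvector `R(z) e` is killed by `L - z`, so a resolvent would force it to vanish; then
  -- `R(z) e = e + zV R(z) e` would give `e = 0`.
  have h := pert_apply_eigenvector isUnit_one_sub_smul_volt (sigFun σ) (oneL b) hz
  have h1 := hR.2 ⟨_, pert_mem_domain hb σ (z • resN (volt b) z (oneL b))⟩
  rw [Lop_pert] at h1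
  simp only [h, sub_self, map_zero] at h1
  have h2 := resN_eq_add isUnit_one_sub_smul_volt (V := volt b) z (oneL b)
  rw [← h1, map_zero, smul_zero, add_zero] at h2
  exact oneL_ne_zero hb h2.symm

theorem IsResolvent.unique {E : Type*} [NormedAddCommGroup E] [NormedSpace ℂ E]
    {A : E →ₗ.[ℂ] E} {z : ℂ} {R R' : E →L[ℂ] E} (h : IsResolvent A z R) (h' : IsResolvent A z R') :
    R = R' := by
  ext f
  obtain ⟨hm, hf⟩ := h'.1 f
  have := h.2 ⟨_, hm⟩
  rwa [hf] at this

theorem resolv_Lop {b : ℝ} (hb : 0 < b) (σ : L2 b) {z : ℂ}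
    (hz : pertDet (volt b) (sigFun σ) (oneL b) z ≠ 0) :
    resolv (Lop b hb σ) z = pertResolvent (volt b) (sigFun σ) (oneL b) z := by
  have h : ∃ R : L2 b →L[ℂ] L2 b, IsResolvent (Lop b hb σ) z R := ⟨_, isResolvent_Lop hb σ hz⟩
  rw [resolv, dif_pos h]
  exact h.choose_spec.unique (isResolvent_Lop hb σ hz)

/-! ### The kernel of the convolution -/

/-- The function `(x, t) ↦ ∫ₜˣ f(x - ξ + t) g(ξ) dξ`. -/
def convKer (f g : ℝ → ℂ) (x t : ℝ) : ℂ := ∫ ξ in t..x, f (x - ξ + t) * g ξ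

theorem conv_eq (b : ℝ) (σ : L2 b) (f g : ℝ → ℂ) (x : ℝ) :
    conv b σ f g x = Complex.I * convKer f g x 0 -
      ∫ μ in (0 : ℝ)..b, (starRingEnd ℂ) (σ μ) * deriv (convKer f g x) μ := by
  simp only [conv, convKer, add_zero]
  rfl

theorem convKer_congr {b : ℝ} {f f' g g' : ℝ → ℂ} (hf : EqOn f f' (Icc 0 b))
    (hg : EqOn g g' (Icc 0 b)) {x t : ℝ} (hx : x ∈ Icc 0 b) (ht : t ∈ Icc 0 b) :
    convKer f g x t = convKer f' g' x t := by
  refine intervalIntegral.integral_congr fun ξ hξ => ?_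
  have h1 : ξ ∈ Icc 0 b := (ordConnected_Icc.uIcc_subset ht hx) hξ
  -- The map `ξ ↦ x - ξ + t` reflects the segment between `t` and `x` onto itself.
  have h2 : x - ξ + t ∈ Icc 0 b := by
    refine (ordConnected_Icc.uIcc_subset ht hx) ?_
    rw [mem_uIcc] at hξ ⊢
    rcases hξ with h | h
    · left; constructor <;> linarith
    · right; constructor <;> linarith
  simp only [hf h2, hg h1]

theorem conv_congr {b : ℝ} (hb : 0 ≤ b) (σ : L2 b) {f f' g g' : ℝ → ℂ} (hf : EqOn f f' (Icc 0 b))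
    (hg : EqOn g g' (Icc 0 b)) {x : ℝ} (hx : x ∈ Icc 0 b) :
    conv b σ f g x = conv b σ f' g' x := by
  rw [conv_eq, conv_eq, convKer_congr hf hg hx ⟨le_rfl, hb⟩, intervalIntegral.integral_of_le hb,
    intervalIntegral.integral_of_le hb]
  congr 1
  refine integral_congr_ae ?_
  filter_upwards [ae_mem_Ioo b] with μ hμ
  congr 1
  refine EventuallyEq.deriv_eq ?_
  filter_upwards [Ioo_mem_nhds hμ.1 hμ.2] with t ht
  exact convKer_congr hf hg hx (Ioo_subset_Icc_self ht)

theorem continuous_convKer {f g : ℝ → ℂ} (hf : Continuous f) (hg : Continuous g) :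
    Continuous (Function.uncurry (convKer f g)) := by
  have hc : Continuous (Function.uncurry fun (p : ℝ × ℝ) ξ => f (p.1 - ξ + p.2) * g ξ) := by
    simp only [Function.uncurry_def]; fun_prop
  have e : Function.uncurry (convKer f g) = fun p : ℝ × ℝ =>
      (∫ ξ in (0 : ℝ)..p.1, f (p.1 - ξ + p.2) * g ξ) -
        ∫ ξ in (0 : ℝ)..p.2, f (p.1 - ξ + p.2) * g ξ := by
    funext p
    have hi : ∀ u v, IntervalIntegrable (fun ξ => f (p.1 - ξ + p.2) * g ξ) volume u v :=
      fun u v => (by fun_prop : Continuous fun ξ => f (p.1 - ξ + p.2) * g ξ).intervalIntegrable _ _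
    exact (intervalIntegral.integral_interval_sub_left (hi _ _) (hi _ _)).symm
  rw [e]
  exact (intervalIntegral.continuous_parametric_intervalIntegral_of_continuous hc
    continuous_fst).sub
    (intervalIntegral.continuous_parametric_intervalIntegral_of_continuous hc continuous_snd)

theorem stronglyMeasurable_conv {b : ℝ} (hb : 0 ≤ b) (σ : L2 b) {f g : ℝ → ℂ}
    (hf : Continuous f) (hg : Continuous g) : StronglyMeasurable (conv b σ f g) := by
  have e : conv b σ f g = fun x => Complex.I * convKer f g x 0 -
      ∫ μ, (starRingEnd ℂ) (σ μ) * deriv (convKer f g x) μ ∂(μI b) := by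
    funext x; rw [conv_eq, intervalIntegral.integral_of_le hb]
  have hK := continuous_convKer hf hg
  rw [e]
  refine StronglyMeasurable.sub ?_ ?_
  · have : Continuous fun x => convKer f g x 0 := hK.comp (continuous_id.prodMk continuous_const)
    exact (continuous_const.mul this).stronglyMeasurable
  · have hσ : StronglyMeasurable fun p : ℝ × ℝ => (starRingEnd ℂ) (σ p.2) :=
      Complex.continuous_conj.comp_stronglyMeasurable
        ((Lp.stronglyMeasurable σ).comp_measurable measurable_snd)
    exact (hσ.mul (stronglyMeasurable_deriv_with_param hK)).integral_prod_right

/-! ### Lipschitz bounds for the kernel -/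

/-- The increment is an integral of `k(y + r)` over `0 < r ≤ d`; Tonelli and translation invariance
bound its `L¹` norm. -/
theorem lintegral_primitive_sub_le {k : ℝ → ℂ} (hk : StronglyMeasurable k) (hi : Integrable k)
    {d : ℝ} (hd : 0 ≤ d) :
    ∫⁻ y, ‖(∫ t in (0 : ℝ)..(y + d), k t) - ∫ t in (0 : ℝ)..y, k t‖ₑ ≤
      ENNReal.ofReal d * ∫⁻ t, ‖k t‖ₑ := by
  have h1 : ∀ y, ‖(∫ t in (0 : ℝ)..(y + d), k t) - ∫ t in (0 : ℝ)..y, k t‖ₑ ≤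
      ∫⁻ r in Ioc 0 d, ‖k (y + r)‖ₑ := by
    intro y
    rw [intervalIntegral.integral_interval_sub_left hi.intervalIntegrable hi.intervalIntegrable]
    have : ∫ t in y..(y + d), k t = ∫ r in (0 : ℝ)..d, k (y + r) := by
      rw [intervalIntegral.integral_comp_add_left (fun t => k t) y, add_zero]
    rw [this, intervalIntegral.integral_of_le hd]
    exact enorm_integral_le_lintegral_enorm _
  refine (lintegral_mono h1).trans ?_
  rw [lintegral_lintegral_swap]
  · simp only [lintegral_add_right_eq_self (fun t => ‖k t‖ₑ)]
    rw [lintegral_const, Measure.restrict_apply_univ, Real.volume_Ioc, sub_zero, mul_comm]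
  · exact (hk.comp_measurable (measurable_fst.add measurable_snd)).enorm.aemeasurable

/-- The function `c + i ∫₀ˣ h`, where `h` is extended by zero. -/
def extFn {b : ℝ} (c : ℂ) (h : L2 b) (x : ℝ) : ℂ :=
  c + Complex.I * ∫ t in (0 : ℝ)..x, (Ioc 0 b).indicator h t

section ExtFn

variable {b : ℝ} (c : ℂ) (h : L2 b)

theorem integrable_indicator_L2 : Integrable ((Ioc 0 b).indicator h) :=
  (integrable_indicator_iff measurableSet_Ioc).2 (L2.integrable h)

theorem continuous_extFn : Continuous (extFn c h) :=
  continuous_const.add (continuous_const.mul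
    (intervalIntegral.continuous_primitive
      (fun _ _ => (integrable_indicator_L2 h).intervalIntegrable) 0))

theorem extFn_eq {x : ℝ} (hx : x ∈ Icc 0 b) : extFn c h x = c + primFn h x := by
  rw [extFn, ← primFn]
  congr 1
  refine primFn_congr (b := b) ?_ hx
  filter_upwards [ae_restrict_mem measurableSet_Ioc] with t ht
  rw [indicator_of_mem ht]

theorem norm_extFn_le (x : ℝ) : ‖extFn c h x‖ ≤ ‖c‖ + ∫ t, ‖h t‖ ∂(μI b) := by
  refine (norm_add_le _ _).trans (add_le_add le_rfl ?_)
  rw [norm_mul, Complex.norm_I, one_mul]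
  refine intervalIntegral.norm_integral_le_integral_norm_uIoc.trans ?_
  refine (setIntegral_le_integral (integrable_indicator_L2 h).norm
    (Eventually.of_forall fun t => norm_nonneg _)).trans_eq ?_
  simp only [norm_indicator_eq_indicator_norm]
  rw [integral_indicator measurableSet_Ioc]

theorem extFn_add (c' : ℂ) (h' : L2 b) {x : ℝ} (hx : x ∈ Icc 0 b) :
    extFn (c + c') (h + h') x = extFn c h x + extFn c' h' x := by
  rw [extFn_eq _ _ hx, extFn_eq _ _ hx, extFn_eq _ _ hx, primFn_congr (Lp.coeFn_add h h') hx]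
  simp only [primFn, Pi.add_apply]
  rw [intervalIntegral.integral_add (L2.intervalIntegrable_of_mem h hx)
    (L2.intervalIntegrable_of_mem h' hx)]
  ring

theorem extFn_smul (a : ℂ) {x : ℝ} (hx : x ∈ Icc 0 b) :
    extFn (a * c) (a • h) x = a * extFn c h x := by
  rw [extFn_eq _ _ hx, extFn_eq _ _ hx, primFn_congr (Lp.coeFn_smul a h) hx]
  simp only [primFn, Pi.smul_apply, smul_eq_mul]
  rw [intervalIntegral.integral_const_mul]
  ring

theorem lintegral_extFn_sub_le {d : ℝ} (hd : 0 ≤ d) :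
    ∫⁻ y, ‖extFn c h (y + d) - extFn c h y‖ₑ ≤
      ENNReal.ofReal (d * ∫ t, ‖h t‖ ∂(μI b)) := by
  have hk : StronglyMeasurable ((Ioc 0 b).indicator h) :=
    (Lp.stronglyMeasurable h).indicator measurableSet_Ioc
  have h1 := lintegral_primitive_sub_le hk (integrable_indicator_L2 h) hd
  have h2 : ∀ y, ‖extFn c h (y + d) - extFn c h y‖ₑ =
      ‖(∫ t in (0 : ℝ)..(y + d), (Ioc 0 b).indicator h t) -
        ∫ t in (0 : ℝ)..y, (Ioc 0 b).indicator h t‖ₑ := by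
    intro y
    rw [extFn, extFn, add_sub_add_left_eq_sub, ← mul_sub, enorm_mul]
    simp [enorm_eq_nnnorm]
  simp only [h2]
  refine h1.trans_eq ?_
  rw [ENNReal.ofReal_mul hd, ofReal_integral_norm_eq_lintegral_enorm (L2.integrable h)]
  congr 1
  simp only [enorm_indicator_eq_indicator_enorm]
  rw [lintegral_indicator measurableSet_Ioc]

variable {g : ℝ → ℂ} (hg : Continuous g) {M : ℝ} (hM : ∀ x ∈ Icc 0 b, ‖g x‖ ≤ M)

include hg hM in
-- Moving the parameter from `s` to `t` changes the shift of `f` and removes the segment `[s, t]`.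
-- The first effect is controlled by the `L¹` modulus of continuity of `f`, although `f` need not be
-- Lipschitz; the second by its supremum. Each contributes one copy of the `L¹` norm of `h`, hence
-- the factor `2`.
theorem norm_convKer_sub_le (hM0 : 0 ≤ M) {x s t : ℝ} (hx : x ∈ Icc 0 b) (hs : s ∈ Icc 0 b)
    (ht : t ∈ Icc 0 b) (hst : s ≤ t) :
    ‖convKer (extFn c h) g x t - convKer (extFn c h) g x s‖ ≤
      M * (‖c‖ + 2 * ∫ r, ‖h r‖ ∂(μI b)) * (t - s) := by
  set f := extFn c h with hf
  set J := ∫ r, ‖h r‖ ∂(μI b) with hJ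
  have hJ0 : 0 ≤ J := integral_nonneg fun r => norm_nonneg (h r)
  have hfc : Continuous f := continuous_extFn c h
  have hi : ∀ r u v, IntervalIntegrable (fun ξ => f (x - ξ + r) * g ξ) volume u v :=
    fun r u v => (by fun_prop : Continuous fun ξ => f (x - ξ + r) * g ξ).intervalIntegrable _ _
  have e : convKer f g x t - convKer f g x s =
      (∫ ξ in t..x, (f (x - ξ + t) - f (x - ξ + s)) * g ξ) -
        ∫ ξ in s..t, f (x - ξ + s) * g ξ := by
    have h1 : ∫ ξ in t..x, (f (x - ξ + t) - f (x - ξ + s)) * g ξ =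
        (∫ ξ in t..x, f (x - ξ + t) * g ξ) - ∫ ξ in t..x, f (x - ξ + s) * g ξ := by
      simp only [sub_mul]
      exact intervalIntegral.integral_sub (hi _ _ _) (hi _ _ _)
    rw [h1, convKer, convKer,
      ← intervalIntegral.integral_add_adjacent_intervals (hi s s t) (hi s t x)]
    ring
  have hsecond : ‖∫ ξ in s..t, f (x - ξ + s) * g ξ‖ ≤ (‖c‖ + J) * M * (t - s) := by
    have := intervalIntegral.norm_integral_le_of_norm_le_const (a := s) (b := t)
      (f := fun ξ => f (x - ξ + s) * g ξ) (C := (‖c‖ + J) * M) (fun ξ hξ => by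
        rw [uIoc_of_le hst] at hξ
        rw [norm_mul]
        exact mul_le_mul (norm_extFn_le c h _) (hM ξ ⟨hs.1.trans hξ.1.le, hξ.2.trans ht.2⟩)
          (norm_nonneg _) (by positivity))
    rwa [abs_of_nonneg (sub_nonneg.2 hst)] at this
  have hfirst : ‖∫ ξ in t..x, (f (x - ξ + t) - f (x - ξ + s)) * g ξ‖ ≤ M * ((t - s) * J) := by
    rw [intervalIntegral.norm_intervalIntegral_eq]
    have hnn : 0 ≤ M * ((t - s) * J) :=
      mul_nonneg hM0 (mul_nonneg (sub_nonneg.2 hst) hJ0)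
    rw [← ENNReal.ofReal_le_ofReal_iff hnn, ofReal_norm]
    refine (enorm_integral_le_lintegral_enorm _).trans ?_
    have hpt : ∀ ξ ∈ uIoc t x, ‖(f (x - ξ + t) - f (x - ξ + s)) * g ξ‖ₑ ≤
        ENNReal.ofReal M * ‖f (x - ξ + t) - f (x - ξ + s)‖ₑ := by
      intro ξ hξ
      have hξ' : ξ ∈ Icc 0 b := ordConnected_Icc.uIcc_subset ht hx (uIoc_subset_uIcc hξ)
      rw [enorm_mul, mul_comm]
      refine mul_le_mul_left ?_ _
      rw [← ofReal_norm]
      exact ENNReal.ofReal_le_ofReal (hM ξ hξ')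
    refine (setLIntegral_mono' measurableSet_uIoc hpt).trans ?_
    refine (setLIntegral_le_lintegral _ _).trans ?_
    rw [lintegral_const_mul' _ _ ENNReal.ofReal_ne_top, ENNReal.ofReal_mul hM0]
    refine mul_le_mul_right ?_ _
    -- The reflection `ξ ↦ x + s - ξ` turns the integral into the `L¹` modulus with increment `t -
    -- s`.
    have hsub := lintegral_sub_left_eq_self (fun y => ‖f (y + (t - s)) - f y‖ₑ) (μ := volume)
      (x + s)
    have e2 : ∀ ξ, ‖f (x - ξ + t) - f (x - ξ + s)‖ₑ =
        ‖f (x + s - ξ + (t - s)) - f (x + s - ξ)‖ₑ := by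
      intro ξ
      rw [show x - ξ + t = x + s - ξ + (t - s) by ring, show x - ξ + s = x + s - ξ by ring]
    simp only [e2]
    rw [hsub]
    exact lintegral_extFn_sub_le c h (sub_nonneg.2 hst)
  rw [e]
  refine (norm_sub_le _ _).trans ((add_le_add hfirst hsecond).trans_eq ?_)
  ring

include hg hM in
theorem lipschitzOnWith_convKer (hM0 : 0 ≤ M) {x : ℝ} (hx : x ∈ Icc 0 b) :
    LipschitzOnWith (Real.toNNReal (M * (‖c‖ + 2 * ∫ r, ‖h r‖ ∂(μI b))))
      (convKer (extFn c h) g x) (Icc 0 b) := by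
  have hJ0 : 0 ≤ ∫ r, ‖h r‖ ∂(μI b) := integral_nonneg fun r => norm_nonneg (h r)
  refine LipschitzOnWith.of_dist_le_mul fun t ht s hs => ?_
  rw [Real.coe_toNNReal _ (by positivity)]
  rcases le_total s t with hst | hst
  · rw [dist_eq_norm, Real.dist_eq, abs_of_nonneg (sub_nonneg.2 hst)]
    exact norm_convKer_sub_le c h hg hM hM0 hx hs ht hst
  · rw [dist_comm, dist_eq_norm, dist_comm, Real.dist_eq, abs_of_nonneg (sub_nonneg.2 hst)]
    exact norm_convKer_sub_le c h hg hM hM0 hx ht hs hst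

include hg hM in
theorem norm_deriv_convKer_le (hM0 : 0 ≤ M) {x μ : ℝ} (hx : x ∈ Icc 0 b) (hμ : μ ∈ Ioo 0 b) :
    ‖deriv (convKer (extFn c h) g x) μ‖ ≤ M * (‖c‖ + 2 * ∫ r, ‖h r‖ ∂(μI b)) := by
  have hJ0 : 0 ≤ ∫ r, ‖h r‖ ∂(μI b) := integral_nonneg fun r => norm_nonneg (h r)
  have := norm_deriv_le_of_lipschitzOn (Icc_mem_nhds hμ.1 hμ.2)
    (lipschitzOnWith_convKer c h hg hM hM0 hx)
  rwa [Real.coe_toNNReal _ (by positivity)] at this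

include hg in
-- A Lipschitz function has bounded variation and is thus differentiable almost everywhere.
-- Additivity of the convolution needs this, as `deriv` is a default zero elsewhere.
theorem ae_differentiableAt_convKer {x : ℝ} (hx : x ∈ Icc 0 b) :
    ∀ᵐ μ ∂(μI b), DifferentiableAt ℝ (convKer (extFn c h) g x) μ := by
  obtain ⟨M, hM⟩ := isCompact_Icc.exists_bound_of_continuousOn (hg.continuousOn (s := Icc 0 b))
  have hM0 : 0 ≤ M := (norm_nonneg _).trans (hM x hx)
  have h1 := ae_restrict_of_ae (s := Ioc 0 b)
    (lipschitzOnWith_convKer c h hg hM hM0 hx).locallyBoundedVariationOn.ae_differentiableWithinAt_of_mem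
  filter_upwards [h1, ae_mem_Ioo b] with μ h2 h3
  exact (h2 (Ioo_subset_Icc_self h3)).differentiableAt (Icc_mem_nhds h3.1 h3.2)

include hg in
theorem integrable_conv_integrand (σ : L2 b) {x : ℝ} (hx : x ∈ Icc 0 b) :
    Integrable (fun μ => (starRingEnd ℂ) (σ μ) * deriv (convKer (extFn c h) g x) μ) (μI b) := by
  obtain ⟨M, hM⟩ := isCompact_Icc.exists_bound_of_continuousOn (hg.continuousOn (s := Icc 0 b))
  have hM0 : 0 ≤ M := (norm_nonneg _).trans (hM x hx)
  have hσ : Integrable (fun μ => (starRingEnd ℂ) (σ μ)) (μI b) :=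
    ((Lp.memLp σ).star).integrable (by norm_num)
  refine hσ.mul_bdd (c := M * (‖c‖ + 2 * ∫ r, ‖h r‖ ∂(μI b)))
    (stronglyMeasurable_deriv _).aestronglyMeasurable ?_
  filter_upwards [ae_mem_Ioo b] with μ hμ
  exact norm_deriv_convKer_le c h hg hM hM0 hx hμ

end ExtFn

/-! ### The convolution as a bounded operator -/

section Conv

variable {b : ℝ} (hb : 0 < b) (σ : L2 b) {g : ℝ → ℂ} (hg : Continuous g)

include hb hg

/-- The constant does not depend on `(c, h)`: this is the continuity on `W¹₂` that the density
argument uses. -/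
theorem exists_norm_conv_le : ∃ K : ℝ, 0 ≤ K ∧ ∀ (c : ℂ) (h : L2 b), ∀ x ∈ Icc 0 b,
    ‖conv b σ (extFn c h) g x‖ ≤ K * (‖c‖ + ∫ t, ‖h t‖ ∂(μI b)) := by
  obtain ⟨M, hM⟩ := isCompact_Icc.exists_bound_of_continuousOn (hg.continuousOn (s := Icc 0 b))
  have hM0 : 0 ≤ M := (norm_nonneg _).trans (hM 0 ⟨le_rfl, hb.le⟩)
  set s := ∫ t, ‖σ t‖ ∂(μI b) with hs
  have hs0 : 0 ≤ s := integral_nonneg fun r => norm_nonneg (σ r)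
  refine ⟨M * b + s * (M * 2), by positivity, fun c h x hx => ?_⟩
  set J := ∫ t, ‖h t‖ ∂(μI b) with hJ
  have hJ0 : 0 ≤ J := integral_nonneg fun r => norm_nonneg (h r)
  have h1 : ‖convKer (extFn c h) g x 0‖ ≤ (‖c‖ + J) * M * b := by
    have := intervalIntegral.norm_integral_le_of_norm_le_const (a := 0) (b := x)
      (f := fun ξ => extFn c h (x - ξ + 0) * g ξ) (C := (‖c‖ + J) * M) (fun ξ hξ => by
        rw [uIoc_of_le hx.1] at hξ
        rw [norm_mul]
        exact mul_le_mul (norm_extFn_le c h _) (hM ξ ⟨hξ.1.le, hξ.2.trans hx.2⟩)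
          (norm_nonneg _) (by positivity))
    rw [sub_zero, abs_of_nonneg hx.1] at this
    exact this.trans (mul_le_mul_of_nonneg_left hx.2 (by positivity))
  have h2 : ‖∫ μ in (0 : ℝ)..b, (starRingEnd ℂ) (σ μ) * deriv (convKer (extFn c h) g x) μ‖ ≤
      s * (M * (‖c‖ + 2 * J)) := by
    rw [intervalIntegral.integral_of_le hb.le, hs, ← integral_mul_const]
    refine norm_integral_le_of_norm_le ((L2.integrable σ).norm.mul_const _) ?_
    filter_upwards [ae_mem_Ioo b] with μ hμ
    rw [norm_mul, RCLike.norm_conj]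
    exact mul_le_mul_of_nonneg_left (norm_deriv_convKer_le c h hg hM hM0 hx hμ) (norm_nonneg _)
  rw [conv_eq]
  refine (norm_sub_le _ _).trans ?_
  rw [norm_mul, Complex.norm_I, one_mul]
  have h3 : s * (M * (‖c‖ + 2 * J)) ≤ s * (M * (2 * (‖c‖ + J))) := by
    have := norm_nonneg c
    gcongr
    linarith
  linarith

theorem memLp_conv (c : ℂ) (h : L2 b) : MemLp (conv b σ (extFn c h) g) 2 (μI b) := by
  obtain ⟨K, -, hK⟩ := exists_norm_conv_le hb σ hg
  refine MemLp.of_bound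
    (stronglyMeasurable_conv hb.le σ (continuous_extFn c h) hg).aestronglyMeasurable
    (K * (‖c‖ + ∫ t, ‖h t‖ ∂(μI b))) ?_
  filter_upwards [ae_mem_Ioo b] with x hx
  exact hK c h x (Ioo_subset_Icc_self hx)

omit hb in
theorem convKer_extFn_add (c c' : ℂ) (h h' : L2 b) {x t : ℝ} (hx : x ∈ Icc 0 b)
    (ht : t ∈ Icc 0 b) : convKer (extFn (c + c') (h + h')) g x t =
      convKer (extFn c h) g x t + convKer (extFn c' h') g x t := by
  have hi : ∀ (c : ℂ) (h : L2 b),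
      IntervalIntegrable (fun ξ => extFn c h (x - ξ + t) * g ξ) volume t x := fun c h => by
    have := continuous_extFn c h
    exact (by fun_prop : Continuous fun ξ => extFn c h (x - ξ + t) * g ξ).intervalIntegrable _ _
  have e : EqOn (extFn (c + c') (h + h')) (fun y => extFn c h y + extFn c' h' y) (Icc 0 b) :=
    fun y hy => extFn_add c h c' h' hy
  rw [convKer_congr e (fun y _ => rfl : EqOn g g (Icc 0 b)) hx ht]
  simp only [convKer, add_mul]
  exact intervalIntegral.integral_add (hi c h) (hi c' h')

omit hb hg in
theorem convKer_extFn_smul (g : ℝ → ℂ) (a c : ℂ) (h : L2 b) {x t : ℝ} (hx : x ∈ Icc 0 b)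
    (ht : t ∈ Icc 0 b) : convKer (extFn (a * c) (a • h)) g x t =
      a * convKer (extFn c h) g x t := by
  have e : EqOn (extFn (a * c) (a • h)) (fun y => a * extFn c h y) (Icc 0 b) :=
    fun y hy => extFn_smul c h a hy
  rw [convKer_congr e (fun y _ => rfl : EqOn g g (Icc 0 b)) hx ht]
  simp only [convKer, mul_assoc]
  exact intervalIntegral.integral_const_mul _ _

theorem conv_extFn_add (c c' : ℂ) (h h' : L2 b) {x : ℝ} (hx : x ∈ Icc 0 b) :
    conv b σ (extFn (c + c') (h + h')) g x =
      conv b σ (extFn c h) g x + conv b σ (extFn c' h') g x := by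
  have e : ∫ μ in (0 : ℝ)..b,
      (starRingEnd ℂ) (σ μ) * deriv (convKer (extFn (c + c') (h + h')) g x) μ =
      (∫ μ in (0 : ℝ)..b, (starRingEnd ℂ) (σ μ) * deriv (convKer (extFn c h) g x) μ) +
      ∫ μ in (0 : ℝ)..b, (starRingEnd ℂ) (σ μ) * deriv (convKer (extFn c' h') g x) μ := by
    simp only [intervalIntegral.integral_of_le hb.le]
    rw [← integral_add (integrable_conv_integrand c h hg σ hx)
      (integrable_conv_integrand c' h' hg σ hx)]
    refine integral_congr_ae ?_
    filter_upwards [ae_differentiableAt_convKer c h hg hx,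
      ae_differentiableAt_convKer c' h' hg hx, ae_mem_Ioo b] with μ h1 h2 h3
    rw [← mul_add, ← deriv_add h1 h2]
    congr 1
    refine EventuallyEq.deriv_eq ?_
    filter_upwards [Ioo_mem_nhds h3.1 h3.2] with t ht
    exact convKer_extFn_add hg c c' h h' hx (Ioo_subset_Icc_self ht)
  rw [conv_eq, conv_eq, conv_eq, e, convKer_extFn_add hg c c' h h' hx ⟨le_rfl, hb.le⟩]
  ring

omit hg in
theorem conv_extFn_smul (a c : ℂ) (h : L2 b) {x : ℝ} (hx : x ∈ Icc 0 b) :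
    conv b σ (extFn (a * c) (a • h)) g x = a * conv b σ (extFn c h) g x := by
  have e : ∫ μ in (0 : ℝ)..b,
      (starRingEnd ℂ) (σ μ) * deriv (convKer (extFn (a * c) (a • h)) g x) μ =
      a * ∫ μ in (0 : ℝ)..b, (starRingEnd ℂ) (σ μ) * deriv (convKer (extFn c h) g x) μ := by
    rw [← intervalIntegral.integral_const_mul, intervalIntegral.integral_of_le hb.le,
      intervalIntegral.integral_of_le hb.le]
    refine integral_congr_ae ?_
    filter_upwards [ae_mem_Ioo b] with μ h3
    rw [mul_left_comm, ← deriv_const_mul_field (v := convKer (extFn c h) g x)]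
    congr 1
    refine EventuallyEq.deriv_eq ?_
    filter_upwards [Ioo_mem_nhds h3.1 h3.2] with t ht
    exact convKer_extFn_smul g a c h hx (Ioo_subset_Icc_self ht)
  rw [conv_eq, conv_eq, e, convKer_extFn_smul g a c h hx ⟨le_rfl, hb.le⟩]
  ring

/-- The operator `(c, h) ↦ (c + i ∫₀ˣ h) ∗ g`. -/
def convL : ℂ × L2 b →L[ℂ] L2 b :=
  LinearMap.mkContinuousOfExistsBound
    { toFun := fun p => (memLp_conv hb σ hg p.1 p.2).toLp (conv b σ (extFn p.1 p.2) g)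
      map_add' := by
        intro p q
        refine Eq.trans ?_ (MemLp.toLp_add _ _)
        refine (MemLp.toLp_eq_toLp_iff _ _).2 ?_
        filter_upwards [ae_mem_Ioo b] with x hx
        exact conv_extFn_add hb σ hg p.1 q.1 p.2 q.2 (Ioo_subset_Icc_self hx)
      map_smul' := by
        intro a p
        refine Eq.trans ?_ (MemLp.toLp_const_smul a _)
        refine (MemLp.toLp_eq_toLp_iff _ _).2 ?_
        filter_upwards [ae_mem_Ioo b] with x hx
        exact conv_extFn_smul hb σ a p.1 p.2 (Ioo_subset_Icc_self hx) }
    (by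
      obtain ⟨C, hC, h1⟩ := exists_integral_norm_le b
      obtain ⟨D, hD, h2⟩ := exists_norm_le_of_ae_bound b
      obtain ⟨K, hK, h3⟩ := exists_norm_conv_le hb σ hg
      refine ⟨D * (K * (1 + C)), fun p => ?_⟩
      have hJ0 : 0 ≤ ∫ t, ‖p.2 t‖ ∂(μI b) := integral_nonneg fun r => norm_nonneg (p.2 r)
      refine (h2 _ (K * (‖p.1‖ + ∫ t, ‖p.2 t‖ ∂(μI b))) (by positivity) ?_).trans ?_
      · filter_upwards [ae_mem_Ioo b, (memLp_conv hb σ hg p.1 p.2).coeFn_toLp] with x hx hx'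
        change ‖((memLp_conv hb σ hg p.1 p.2).toLp (conv b σ (extFn p.1 p.2) g)) x‖ ≤ _
        rw [hx']
        exact h3 p.1 p.2 x (Ioo_subset_Icc_self hx)
      · have e1 : ‖p.1‖ ≤ ‖p‖ := norm_fst_le p
        have e2 : C * ‖p.2‖ ≤ C * ‖p‖ := mul_le_mul_of_nonneg_left (norm_snd_le p) hC
        have e3 : ‖p.1‖ + ∫ t, ‖p.2 t‖ ∂(μI b) ≤ (1 + C) * ‖p‖ := by
          have := h1 p.2
          linarith
        calc D * (K * (‖p.1‖ + ∫ t, ‖p.2 t‖ ∂(μI b))) ≤ D * (K * ((1 + C) * ‖p‖)) := by gcongr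
          _ = _ := by ring)

theorem convL_ae (c : ℂ) (h : L2 b) :
    convL hb σ hg (c, h) =ᵐ[μI b] conv b σ (extFn c h) g :=
  (memLp_conv hb σ hg c h).coeFn_toLp

/-! ### Convolution with exponentials -/

omit hb in
theorem hasDerivAt_primFn_of_continuous (x : ℝ) :
    HasDerivAt (primFn g) (Complex.I * g x) x :=
  (intervalIntegral.integral_hasDerivAt_right (hg.intervalIntegrable _ _)
    (hg.stronglyMeasurableAtFilter _ _) hg.continuousAt).const_mul Complex.I

omit hb hg in
/-- The solution of `-i y' = a y + g`, `y(0) = 0`. -/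
def expPrim (a : ℂ) (g : ℝ → ℂ) (x : ℝ) : ℂ :=
  expMon a 0 x * primFn (fun ξ => expMon (-a) 0 ξ * g ξ) x

omit hb hg in
theorem expMon_mul_neg (a : ℂ) (x : ℝ) : expMon a 0 x * expMon (-a) 0 x = 1 := by
  simp [expMon, ← Complex.exp_add]

omit hb in
theorem hasDerivAt_expPrim (a : ℂ) (x : ℝ) :
    HasDerivAt (expPrim a g) (Complex.I * (g x + a * expPrim a g x)) x := by
  have h := (hasDerivAt_expMon_zero a x).mul
    (hasDerivAt_primFn_of_continuous ((continuous_expMon (-a) 0).mul hg) x)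
  refine h.congr_deriv ?_
  simp only [expPrim, Pi.mul_apply]
  change _ + _ * (_ * (expMon (-a) 0 x * g x)) =
    Complex.I * (g x + a * (expMon a 0 x * primFn (expMon (-a) 0 * g) x))
  linear_combination Complex.I * g x * expMon_mul_neg a x

omit hb in
theorem continuous_expPrim (a : ℂ) : Continuous (expPrim a g) :=
  continuous_iff_continuousAt.2 fun x => (hasDerivAt_expPrim hg a x).continuousAt

omit hb in
theorem resN_volt_ofCont (a : ℂ) :
    resN (volt b) a (volt b (ofCont b g hg)) = ofCont b (expPrim a g) (continuous_expPrim hg a) := by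
  symm
  refine eq_resN_of_sub isUnit_one_sub_smul_volt ?_
  have hc := continuous_expPrim hg a
  have hv : volt b (ofCont b (g + a • expPrim a g) (hg.add (hc.const_smul a))) =
      ofCont b (expPrim a g) hc := by
    refine volt_ofCont _ _ fun x _ => ?_
    refine (primFn_eq_of_hasDerivAt (φ := expPrim a g) (fun y => hasDerivAt_expPrim hg a y)
      (hg.add (hc.const_smul a)) x).trans ?_
    simp [expPrim, primFn]
  rw [← map_smul, sub_eq_iff_eq_add, ← map_add]
  exact hv.symm

omit hb in
theorem resN_ofCont (a : ℂ) : resN (volt b) a (ofCont b g hg) =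
    ofCont b (g + a • expPrim a g) (hg.add ((continuous_expPrim hg a).const_smul a)) := by
  rw [resN_eq_add' isUnit_one_sub_smul_volt, resN_volt_ofCont]
  rfl

omit hb in
-- The exponential splits as `exp(iax) exp(iat) exp(-iaξ)`, leaving a difference of primitives.
theorem convKer_expMon (a : ℂ) (x t : ℝ) : convKer (expMon a 0) g x t =
    -Complex.I * (expMon a 0 t * expPrim a g x - expMon a 0 x * expPrim a g t) := by
  set k : ℝ → ℂ := fun ξ => expMon (-a) 0 ξ * g ξ with hk
  have hkc : Continuous k := (continuous_expMon (-a) 0).mul hg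
  have e : ∀ ξ, expMon a 0 (x - ξ + t) * g ξ = (expMon a 0 x * expMon a 0 t) * k ξ := by
    intro ξ
    simp only [expMon, hk, pow_zero, Nat.factorial_zero, Nat.cast_one, div_one, one_mul]
    rw [← mul_assoc, ← Complex.exp_add, ← Complex.exp_add]
    congr 2
    push_cast
    ring
  have hi : ∀ u v, IntervalIntegrable k volume u v := fun u v => hkc.intervalIntegrable u v
  simp only [convKer, e, expPrim]
  rw [intervalIntegral.integral_const_mul,
    ← intervalIntegral.integral_interval_sub_left (hi 0 x) (hi 0 t), primFn, primFn]
  linear_combination (expMon a 0 x * expMon a 0 t * ((∫ ξ in (0 : ℝ)..x, k ξ) -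
    ∫ ξ in (0 : ℝ)..t, k ξ)) * Complex.I_mul_I

/-- The integral from `0` to `x` yields `expPrim a g x`, and the `σ` term completes its coefficient
to `1 - a S(R(a) e)`. The remaining part pairs `σ` with `g + a • expPrim a g`, which is `R(a) g`. -/
theorem conv_expMon (a : ℂ) {x : ℝ} : conv b σ (expMon a 0) g x =
    pertDet (volt b) (sigFun σ) (oneL b) a * expPrim a g x +
      sigFun σ (resN (volt b) a (ofCont b g hg)) * expMon a 0 x := by
  have hder : ∀ μ, deriv (convKer (expMon a 0) g x) μ =
      a * expMon a 0 μ * expPrim a g x - (g μ + a * expPrim a g μ) * expMon a 0 x := by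
    intro μ
    have hf : convKer (expMon a 0) g x = fun t => -Complex.I *
        (expMon a 0 t * expPrim a g x - expMon a 0 x * expPrim a g t) :=
      funext fun t => convKer_expMon hg a x t
    rw [hf]
    refine ((((hasDerivAt_expMon_zero a μ).mul_const (expPrim a g x)).sub
      ((hasDerivAt_expPrim hg a μ).const_mul (expMon a 0 x))).const_mul (-Complex.I)).deriv.trans ?_
    linear_combination (-(a * expMon a 0 μ * expPrim a g x -
      (g μ + a * expPrim a g μ) * expMon a 0 x)) * Complex.I_mul_I
  have hσ : ∀ f : ℝ → ℂ, Continuous f →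
      IntervalIntegrable (fun μ => f μ * (starRingEnd ℂ) (σ μ)) volume 0 b := fun f hf =>
    (intervalIntegrable_iff_integrableOn_Ioc_of_le hb.le).2
      ((memLp_of_continuous hf).integrable_mul (Lp.memLp σ).star)
  have hc := continuous_expPrim hg a
  rw [conv_eq, pertDet, resN_volt_oneL, resN_ofCont, sigFun_eq hb.le σ (ofCont_ae _),
    sigFun_eq hb.le σ (ofCont_ae _)]
  have e : ∫ μ in (0 : ℝ)..b, (starRingEnd ℂ) (σ μ) * deriv (convKer (expMon a 0) g x) μ =
      (a * expPrim a g x) * (∫ μ in (0 : ℝ)..b, expMon a 0 μ * (starRingEnd ℂ) (σ μ)) -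
      expMon a 0 x *
        ∫ μ in (0 : ℝ)..b, (g + a • expPrim a g) μ * (starRingEnd ℂ) (σ μ) := by
    rw [← intervalIntegral.integral_const_mul, ← intervalIntegral.integral_const_mul,
      ← intervalIntegral.integral_sub ((hσ _ (continuous_expMon a 0)).const_mul _)
        ((hσ _ (hg.add (hc.const_smul a))).const_mul _)]
    congr 1
    funext μ
    rw [hder, Pi.add_apply, Pi.smul_apply, smul_eq_mul]
    ring
  have h0 : expPrim a g 0 = 0 := by simp [expPrim, primFn]
  have h1 : expMon a 0 0 = 1 := by simp [expMon]
  rw [e, convKer_expMon hg, h0, h1]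
  linear_combination (-(expPrim a g x)) * Complex.I_mul_I

/-- The pair `(1, a R(a) e)` encodes the exponential itself, because `R(a) e = e + V(a R(a) e)`. -/
theorem convL_exp (a : ℂ) :
    convL hb σ hg (1, a • resN (volt b) a (oneL b)) =
      expConv (volt b) (sigFun σ) (oneL b) a (ofCont b g hg) := by
  have e : EqOn (extFn 1 (a • resN (volt b) a (oneL b))) (expMon a 0) (Icc 0 b) := by
    intro x hx
    have h1 : (a • resN (volt b) a (oneL b) : L2 b) =ᵐ[μI b] fun y => a * expMon a 0 y := by
      rw [resN_volt_oneL]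
      filter_upwards [Lp.coeFn_smul a (ofCont b (expMon a 0) (continuous_expMon a 0)),
        ofCont_ae (b := b) (continuous_expMon a 0)] with y h1 h2
      rw [h1, Pi.smul_apply, h2, smul_eq_mul]
    rw [extFn_eq _ _ hx, primFn_congr h1 hx,
      primFn_eq_of_hasDerivAt (φ := expMon a 0)
        (fun y => (hasDerivAt_expMon_zero a y).congr_deriv (mul_assoc _ _ _))
        (continuous_const.mul (continuous_expMon a 0))]
    simp [expMon]
  refine Lp.ext ?_
  rw [expConv, resN_volt_ofCont]
  set D := pertDet (volt b) (sigFun σ) (oneL b) a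
  set s := sigFun σ (resN (volt b) a (ofCont b g hg))
  have c1 := continuous_expPrim hg a
  have c2 := continuous_expMon a 0
  nth_rewrite 2 [resN_volt_oneL]
  filter_upwards [convL_ae hb σ hg 1 (a • resN (volt b) a (oneL b)), ae_mem_Ioo b,
    Lp.coeFn_add (D • ofCont b _ c1) (s • ofCont b _ c2), Lp.coeFn_smul D (ofCont b _ c1),
    Lp.coeFn_smul s (ofCont b _ c2), ofCont_ae (b := b) c1, ofCont_ae (b := b) c2]
    with x h1 hx h2 h3 h4 h5 h6
  rw [h1, conv_congr hb.le σ e (fun y _ => rfl : EqOn g g (Icc 0 b)) (Ioo_subset_Icc_self hx),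
    conv_expMon hb σ hg, h2, Pi.add_apply, h3, h4, Pi.smul_apply, Pi.smul_apply, h5, h6,
    smul_eq_mul, smul_eq_mul]

end Conv

/-! ### Density of polynomials -/

theorem sum_smul_ofCont {b : ℝ} {ι : Type*} (s : Finset ι) (a : ι → ℂ) (f : ι → ℝ → ℂ)
    (hf : ∀ i, Continuous (f i)) :
    ∑ i ∈ s, a i • ofCont b (f i) (hf i) =
      ofCont b (fun x => ∑ i ∈ s, a i * f i x)
        (continuous_finsetSum s fun i _ => continuous_const.mul (hf i)) := by
  classical
  induction s using Finset.induction_on with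
  | empty => simp only [Finset.sum_empty]; rfl
  | insert i s hi ih =>
    rw [Finset.sum_insert hi, ih]
    simp only [Finset.sum_insert hi]
    rfl

theorem clm_polynomial_eq_zero {b : ℝ} {l : L2 b →L[ℂ] ℂ}
    (h : ∀ n, l (ofCont b (expMon 0 n) (continuous_expMon 0 n)) = 0) (p : Polynomial ℝ) :
    l (ofCont b (fun x => ((p.eval x : ℝ) : ℂ)) (Complex.continuous_ofReal.comp p.continuous)) =
      0 := by
  have e : (fun x : ℝ => ((p.eval x : ℝ) : ℂ)) = fun x => ∑ i ∈ Finset.range (p.natDegree + 1),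
      (p.coeff i * i.factorial / Complex.I ^ i) * expMon 0 i x := by
    funext x
    rw [Polynomial.eval_eq_sum_range]
    push_cast
    refine Finset.sum_congr rfl fun i _ => ?_
    have h1 : (i.factorial : ℂ) ≠ 0 := Nat.cast_ne_zero.2 i.factorial_ne_zero
    have h2 : Complex.I ^ i ≠ 0 := pow_ne_zero _ Complex.I_ne_zero
    simp only [expMon, mul_zero, zero_mul, Complex.exp_zero, mul_one, mul_pow]
    field_simp
  have e2 := sum_smul_ofCont (b := b) (Finset.range (p.natDegree + 1))
    (fun i => (p.coeff i * i.factorial / Complex.I ^ i : ℂ)) (expMon 0) (continuous_expMon 0)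
  simp only [← e] at e2
  rw [← e2, map_sum]
  exact Finset.sum_eq_zero fun i _ => by rw [map_smul, h, smul_zero]

/-- At `w = 0` the `expMon` are multiples of the monomials. Weierstrass approximation of real and
imaginary parts reaches continuous functions, and bounded continuous functions are dense in `L₂`. -/
theorem clm_eq_zero_of_expMon {b : ℝ} {l : L2 b →L[ℂ] ℂ}
    (h : ∀ n, l (ofCont b (expMon 0 n) (continuous_expMon 0 n)) = 0) : l = 0 := by
  obtain ⟨D, hD, h2⟩ := exists_norm_le_of_ae_bound b
  have hcont : ∀ (φ : ℝ → ℂ) (hφ : Continuous φ), l (ofCont b φ hφ) = 0 := by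
    intro φ hφ
    have hle : ∀ ε > 0, ‖l (ofCont b φ hφ)‖ ≤ ‖l‖ * (D * (2 * ε)) := by
      intro ε hε
      obtain ⟨p, hp⟩ := exists_polynomial_near_of_continuousOn 0 b (fun x => (φ x).re)
        (Complex.continuous_re.comp hφ).continuousOn ε hε
      obtain ⟨q, hq⟩ := exists_polynomial_near_of_continuousOn 0 b (fun x => (φ x).im)
        (Complex.continuous_im.comp hφ).continuousOn ε hε
      have cp : Continuous fun x => ((p.eval x : ℝ) : ℂ) :=
        Complex.continuous_ofReal.comp p.continuous
      have cq : Continuous fun x => ((q.eval x : ℝ) : ℂ) :=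
        Complex.continuous_ofReal.comp q.continuous
      have cpq : Continuous fun x => φ x - (((p.eval x : ℝ) : ℂ) + Complex.I * (q.eval x : ℝ)) :=
        hφ.sub (cp.add (continuous_const.mul cq))
      have e : ofCont b φ hφ = ofCont b _ cpq + (ofCont b _ cp + Complex.I • ofCont b _ cq) := by
        rw [← sub_eq_iff_eq_add]
        rfl
      rw [e, map_add, map_add, map_smul, clm_polynomial_eq_zero h, clm_polynomial_eq_zero h,
        smul_zero, add_zero, add_zero]
      refine (l.le_opNorm _).trans (mul_le_mul_of_nonneg_left (h2 _ _ (by positivity) ?_)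
        (norm_nonneg _))
      filter_upwards [ofCont_ae (b := b) cpq, ae_mem_Ioo b] with x hx hx'
      rw [hx]
      refine (Complex.norm_le_abs_re_add_abs_im _).trans ?_
      have h3 := hp x (Ioo_subset_Icc_self hx')
      have h4 := hq x (Ioo_subset_Icc_self hx')
      rw [abs_sub_comm] at h3 h4
      simp only [Complex.sub_re, Complex.add_re, Complex.ofReal_re, Complex.mul_re, Complex.I_re,
        Complex.I_im, Complex.ofReal_im, Complex.sub_im, Complex.add_im, Complex.mul_im]
      norm_num
      linarith
    have hlim : Tendsto (fun ε : ℝ => ‖l‖ * (D * (2 * ε))) (𝓝[>] 0) (𝓝 0) := by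
      have : Continuous fun ε : ℝ => ‖l‖ * (D * (2 * ε)) := by fun_prop
      simpa using (this.tendsto 0).mono_left nhdsWithin_le_nhds
    have := ge_of_tendsto hlim (by
      filter_upwards [self_mem_nhdsWithin] with ε hε using hle ε hε)
    exact norm_le_zero_iff.1 this
  have hd := BoundedContinuousFunction.toLp_denseRange (α := ℝ) (p := 2) ℂ (μI b) ℂ (by norm_num)
  refine ContinuousLinearMap.coeFn_injective
    (hd.equalizer l.continuous (0 : L2 b →L[ℂ] ℂ).continuous ?_)
  funext f
  have e : BoundedContinuousFunction.toLp (E := ℂ) 2 (μI b) ℂ f = ofCont b f f.continuous :=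
    Lp.ext ((BoundedContinuousFunction.coeFn_toLp 2 (μI b) ℂ f).trans
      (ofCont_ae f.continuous).symm)
  rw [Function.comp_apply, e, hcont]
  rfl

/-! ### Multiplicativity of the coefficients -/

theorem coefFun_convL {b : ℝ} (hb : 0 < b) (σ : L2 b) {g : ℝ → ℂ} (hg : Continuous g) {w : ℂ}
    {k m : ℕ} (hk : k < m) (hw : pertDet (volt b) (sigFun σ) (oneL b) w = 0)
    (hm : ∀ i < m, iteratedDeriv i (pertDet (volt b) (sigFun σ) (oneL b)) w = 0)
    (c : ℂ) (h : L2 b) :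
    coefFun (volt b) (sigFun σ) w k (convL hb σ hg (c, h)) =
      ∑ p ∈ Finset.HasAntidiagonal.antidiagonal k,
        coefFun (volt b) (sigFun σ) w p.1 (c • oneL b + volt b h) *
          coefFun (volt b) (sigFun σ) w p.2 (ofCont b g hg) := by
  have hV := isUnit_one_sub_smul_volt (b := b)
  set C := coefFun (volt b) (sigFun σ) w with hC
  set G := ofCont b g hg with hG
  have hw0 : w ≠ 0 := by
    rintro rfl
    rw [pertDet_zero] at hw
    exact one_ne_zero hw
  let T : ℂ × L2 b →L[ℂ] L2 b :=
    (ContinuousLinearMap.fst ℂ ℂ (L2 b)).smulRight (oneL b) +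
      volt b ∘L ContinuousLinearMap.snd ℂ ℂ (L2 b)
  -- The defect of multiplicativity is a bounded functional of `(c, h)`; here `T (c, h)` is the
  -- function `c + V h`.
  let l : ℂ × L2 b →L[ℂ] ℂ := C k ∘L convL hb σ hg -
    ∑ p ∈ Finset.HasAntidiagonal.antidiagonal k, (C p.2 G) • (C p.1 ∘L T)
  have hl : ∀ p, l p = C k (convL hb σ hg p) -
      ∑ r ∈ Finset.HasAntidiagonal.antidiagonal k,
        C r.1 (p.1 • oneL b + volt b p.2) * C r.2 G := by
    intro p
    simp only [l, sub_apply, ContinuousLinearMap.comp_apply, sum_apply,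
      smul_apply, smul_eq_mul]
    congr 1
    exact Finset.sum_congr rfl fun r _ => mul_comm _ _
  have hexp : ∀ a ≠ w, l (1, 0) + (l ∘L ContinuousLinearMap.inr ℂ ℂ (L2 b))
      (a • resN (volt b) a (oneL b)) = 0 := by
    intro a ha
    rw [ContinuousLinearMap.comp_apply, ContinuousLinearMap.inr_apply, ← map_add,
      Prod.mk_add_mk, add_zero, zero_add, hl, convL_exp]
    simp only [one_smul, map_smul]
    rw [← resN_eq_add hV, coefFun_expConv hV _ _ ha hm _ hk, sub_self]
  obtain ⟨h1, h2⟩ := eq_zero_of_forall_resN hV (oneL b) hw0 _ _ hexp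
  have h3 : l ∘L ContinuousLinearMap.inr ℂ ℂ (L2 b) = 0 :=
    clm_eq_zero_of_expMon fun n => by rw [← volt_pow_oneL]; exact h2 n
  have h4 : l (c, h) = 0 := by
    have e : ((c, h) : ℂ × L2 b) = c • (1, 0) + ContinuousLinearMap.inr ℂ ℂ (L2 b) h := by
      simp
    have h5 := DFunLike.congr_fun h3 h
    rw [ContinuousLinearMap.comp_apply] at h5
    rw [e, map_add, map_smul, h1, h5]
    simp
  rw [hl] at h4
  exact sub_eq_zero.1 h4

/-! ### Root functions -/

section Root

variable {b : ℝ} (hb : 0 < b) (σ : L2 b) (w : ℂ)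

theorem mult_eq (hb : 0 ≤ b) :
    mult b σ w = analyticOrderNatAt (pertDet (volt b) (sigFun σ) (oneL b)) w := by
  rw [mult, charFn_eq_pertDet hb]

/-- The function `(z - w)^m / Δ(z)` and its Taylor coefficients. -/
theorem exists_taylorCoeff (hb : 0 ≤ b) : ∃ q : ℂ → ℂ,
    (∀ z, z ≠ w → q z = (z - w) ^ mult b σ w / pertDet (volt b) (sigFun σ) (oneL b) z) ∧
    AnalyticAt ℂ q w ∧ q w ≠ 0 ∧
    ∀ j : ℕ, taylorCoeff b σ w j / (j.factorial : ℂ) = taylorCoef j q w := by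
  have hV := isUnit_one_sub_smul_volt (b := b)
  obtain ⟨q, h1, h2, h3⟩ := exists_regularized_inv
    ((differentiable_pertDet hV (sigFun σ) (oneL b)).analyticAt w)
    (analyticOrderAt_pertDet_ne_top hV (sigFun σ) (oneL b) w)
  refine ⟨q, by rwa [mult_eq σ w hb], h2, h3, fun j => ?_⟩
  rw [taylorCoeff, charFn_eq_pertDet hb, limUnder_iteratedDeriv_eq h2 (by rwa [mult_eq σ w hb]),
    taylorCoef, smul_eq_mul, div_eq_inv_mul]

theorem rootFn_eq (s : ℕ) (x : ℝ) : rootFn b σ w s x =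
    -∑ r ∈ Finset.HasAntidiagonal.antidiagonal s,
      taylorCoeff b σ w r.1 / (r.1.factorial : ℂ) * expMon w r.2 x := by
  rw [Finset.Nat.sum_antidiagonal_eq_sum_range_succ (fun i j =>
    taylorCoeff b σ w i / (i.factorial : ℂ) * expMon w j x), rootFn]
  congr 1
  exact Finset.sum_congr rfl fun j _ => by rw [expMon]; ring

theorem continuous_rootFn (s : ℕ) : Continuous (rootFn b σ w s) := by
  unfold rootFn; fun_prop

/-- On the circle the resolvent is the explicit one, so the residue formula applies with `n + 1 =
m`. The inner sums are `-u_s`, and their sign cancels that of the Riesz projection. -/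
theorem rieszProj_Lop (hw : w ∈ spec (Lop b hb σ)) (f : L2 b) :
    rieszProj (Lop b hb σ) w f =
      ∑ p ∈ Finset.HasAntidiagonal.antidiagonal (mult b σ w - 1),
        coefFun (volt b) (sigFun σ) w p.1 f •
          ofCont b (rootFn b σ w p.2) (continuous_rootFn σ w p.2) := by
  have hV := isUnit_one_sub_smul_volt (b := b)
  obtain ⟨ε, hε, hε'⟩ := exists_pertDet_ne_zero hV (sigFun σ) (oneL b) w
  -- The chosen radius is isolating because some isolating radius exists.
  have hδ : IsIsolatingRadius (Lop b hb σ) w (isolatingRadius (Lop b hb σ) w) :=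
    Classical.epsilon_spec (p := IsIsolatingRadius (Lop b hb σ) w)
      ⟨ε, hε, fun z hz hz' => hε' z hz' ((mem_spec_Lop hb σ z).1 hz)⟩
  have hpos := analyticOrderNatAt_pertDet_pos hV _ _ ((mem_spec_Lop hb σ w).1 hw)
  rw [← mult_eq σ w hb.le] at hpos
  obtain ⟨q, h1, h2, -, h4⟩ := exists_taylorCoeff σ w hb.le
  have hres := circleIntegral_pertResolvent hV (sigFun σ) (oneL b) hδ.1
    (fun z hz h0 => hδ.2 z ((mem_spec_Lop hb σ z).2 h0) hz) (n := mult b σ w - 1)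
    (by rwa [Nat.sub_add_cancel hpos]) h2 f
  have hint : (∮ z in C(w, isolatingRadius (Lop b hb σ) w), resolv (Lop b hb σ) z f) =
      ∮ z in C(w, isolatingRadius (Lop b hb σ) w),
        pertResolvent (volt b) (sigFun σ) (oneL b) z f := by
    refine circleIntegral.integral_congr hδ.1.le fun z hz => ?_
    have hne : pertDet (volt b) (sigFun σ) (oneL b) z ≠ 0 := fun h0 => by
      have := hδ.2 z ((mem_spec_Lop hb σ z).2 h0) (Metric.sphere_subset_closedBall hz)
      rw [this, Metric.mem_sphere, dist_self] at hz
      exact hδ.1.ne hz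
    rw [resolv_Lop hb σ hne]
  rw [rieszProj, hint, neg_smul, hres, ← Finset.sum_neg_distrib]
  refine Finset.sum_congr rfl fun p _ => ?_
  rw [← smul_neg]
  congr 1
  simp only [volt_pow_resN_oneL, ← h4]
  rw [sum_smul_ofCont _ (fun r : ℕ × ℕ => taylorCoeff b σ w r.1 / (r.1.factorial : ℂ))
    (fun r => expMon w r.2) (fun r => continuous_expMon w r.2)]
  have e : rootFn b σ w p.2 = -fun x => ∑ r ∈ Finset.HasAntidiagonal.antidiagonal p.2,
      taylorCoeff b σ w r.1 / (r.1.factorial : ℂ) * expMon w r.2 x := by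
    funext x
    exact rootFn_eq σ w p.2 x
  simp only [e]
  rfl

theorem isRootCoeff_coefFun (hw : w ∈ spec (Lop b hb σ)) (f : L2 b) :
    IsRootCoeff b hb σ w f fun k => coefFun (volt b) (sigFun σ) w k f := by
  have hpos := analyticOrderNatAt_pertDet_pos isUnit_one_sub_smul_volt _ _
    ((mem_spec_Lop hb σ w).1 hw)
  rw [← mult_eq σ w hb.le] at hpos
  rw [IsRootCoeff, rieszProj_Lop hb σ w hw,
    sum_smul_ofCont _ (fun p : ℕ × ℕ => coefFun (volt b) (sigFun σ) w p.1 f)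
      (fun p => rootFn b σ w p.2) (fun p => continuous_rootFn σ w p.2)]
  refine (ofCont_ae _).trans (Eventually.of_forall fun x => ?_)
  -- The index `rev k` has value `m - (k + 1)`, so each pair of indices adds up to `m - 1`, as in
  -- the antidiagonal sum.
  simp only [Fin.val_rev]
  rw [Fin.sum_univ_eq_sum_range (fun k => coefFun (volt b) (sigFun σ) w (mult b σ w - (k + 1)) f *
    rootFn b σ w k x), ← Finset.Nat.sum_antidiagonal_swap]
  simp only [Prod.fst_swap, Prod.snd_swap]
  rw [Finset.Nat.sum_antidiagonal_eq_sum_range_succ (fun i j =>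
    coefFun (volt b) (sigFun σ) w j f * rootFn b σ w i x), Nat.succ_eq_add_one,
    Nat.sub_add_cancel hpos]
  refine Finset.sum_congr rfl fun k _ => ?_
  rw [Nat.sub_sub, Nat.add_comm 1 k]

/-- The polynomial factors of the root functions. -/
def rootSeq (t : ℕ → ℂ) (ht : t 0 ≠ 0) : Polynomial.Sequence ℂ where
  elems' k := ∑ j ∈ Finset.range (k + 1),
    Polynomial.C (t (k - j) * (Complex.I ^ j / j.factorial)) * Polynomial.X ^ j
  degree_eq' k := by
    have h0 : t (k - k) * (Complex.I ^ k / k.factorial) ≠ 0 := by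
      rw [Nat.sub_self]
      exact mul_ne_zero ht (div_ne_zero (pow_ne_zero _ Complex.I_ne_zero)
        (Nat.cast_ne_zero.2 k.factorial_ne_zero))
    rw [Finset.sum_range_succ, Polynomial.degree_add_eq_right_of_degree_lt,
      Polynomial.degree_C_mul_X_pow _ h0]
    rw [Polynomial.degree_C_mul_X_pow _ h0]
    refine (Polynomial.degree_sum_le _ _).trans_lt
      ((Finset.sup_lt_iff (WithBot.bot_lt_coe k)).2 fun j hj => ?_)
    exact (Polynomial.degree_C_mul_X_pow_le _ _).trans_lt
      (Nat.cast_lt.2 (Finset.mem_range.1 hj))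

theorem rootFn_eq_rootSeq (t : ℕ → ℂ) (ht : t 0 ≠ 0)
    (h : ∀ j, taylorCoeff b σ w j / (j.factorial : ℂ) = t j) (s : ℕ) (x : ℝ) :
    rootFn b σ w s x =
      -((rootSeq t ht s).eval (x : ℂ) * Complex.exp (Complex.I * w * x)) := by
  have e : (rootSeq t ht s : Polynomial ℂ) = ∑ j ∈ Finset.range (s + 1),
    Polynomial.C (t (s - j) * (Complex.I ^ j / j.factorial)) * Polynomial.X ^ j := rfl
  rw [rootFn_eq, e, ← Finset.Nat.sum_antidiagonal_swap]
  simp only [Prod.fst_swap, Prod.snd_swap, h]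
  rw [Finset.Nat.sum_antidiagonal_eq_sum_range_succ (fun i j => t j * expMon w i x),
    Polynomial.eval_finsetSum, Finset.sum_mul]
  congr 1
  refine Finset.sum_congr rfl fun j _ => ?_
  simp only [Polynomial.eval_mul, Polynomial.eval_C, Polynomial.eval_pow, Polynomial.eval_X, expMon,
    mul_pow]
  ring

include hb in
-- By continuity the sum vanishes throughout `(0, b)`. After division by the exponential a
-- polynomial with infinitely many roots remains; its summands have distinct exact degrees because
-- `d_0 ≠ 0`.
theorem eq_zero_of_sum_rootFn {m : ℕ} (a : Fin m → ℂ)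
    (h : (fun x => ∑ k : Fin m, a k * rootFn b σ w k x) =ᵐ[μI b] fun _ => 0) : a = 0 := by
  obtain ⟨q, -, -, h3, h4⟩ := exists_taylorCoeff σ w hb.le
  have ht : taylorCoef 0 q w ≠ 0 := by simpa [taylorCoef] using h3
  have h' : (fun x => ∑ k : Fin m, a k * rootFn b σ w k x) =ᵐ[volume.restrict (Ioo 0 b)]
      fun _ => 0 := by
    rwa [Measure.restrict_congr_set Ioo_ae_eq_Ioc]
  have hc : Continuous fun x => ∑ k : Fin m, a k * rootFn b σ w k x :=
    continuous_finsetSum _ fun k _ => continuous_const.mul (continuous_rootFn σ w k)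
  have he := Measure.eqOn_Ioo_of_ae_eq volume h' hc.continuousOn continuousOn_const
  set P := rootSeq (fun j => taylorCoef j q w) ht with hP
  have hz : ∑ k : Fin m, a k • (P k : Polynomial ℂ) = 0 := by
    refine Polynomial.eq_zero_of_infinite_isRoot _ ?_
    refine ((Ioo_infinite hb).image (Complex.ofReal_injective.injOn)).mono ?_
    rintro _ ⟨x, hx, rfl⟩
    have h5 := he hx
    simp only [rootFn_eq_rootSeq σ w _ ht h4, ← hP] at h5
    have h6 : (∑ k : Fin m, a k • (P k : Polynomial ℂ)).eval (x : ℂ) *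
        Complex.exp (Complex.I * w * x) = 0 := by
      rw [Polynomial.eval_finsetSum, Finset.sum_mul, ← neg_eq_zero, ← Finset.sum_neg_distrib,
        ← h5]
      refine Finset.sum_congr rfl fun k _ => ?_
      rw [Polynomial.eval_smul, smul_eq_mul]
      ring
    exact (mul_eq_zero.1 h6).resolve_right (Complex.exp_ne_zero _)
  have hli := P.linearIndependent.comp (fun k : Fin m => (k : ℕ)) Fin.val_injective
  funext k
  exact Fintype.linearIndependent_iff.1 hli a hz k

theorem IsRootCoeff.unique {f : L2 b} {c c' : Fin (mult b σ w) → ℂ}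
    (h : IsRootCoeff b hb σ w f c) (h' : IsRootCoeff b hb σ w f c') : c = c' := by
  have := eq_zero_of_sum_rootFn hb σ w (fun k => c (Fin.rev k) - c' (Fin.rev k)) (by
    filter_upwards [h, h'] with x h1 h2
    simp only [sub_mul, Finset.sum_sub_distrib]
    rw [← h1, ← h2, sub_self])
  funext k
  have h2 := congrFun this (Fin.rev k)
  simpa [sub_eq_zero] using h2

theorem fourier_eq_coefFun (w : spec (Lop b hb σ)) (f : L2 b) (k : Fin (mult b σ w)) :
    fourier b hb σ f w k = coefFun (volt b) (sigFun σ) w k f := by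
  have h := isRootCoeff_coefFun hb σ w w.2 f
  have h2 : IsRootCoeff b hb σ w f (fourier b hb σ f w) :=
    Classical.epsilon_spec (p := IsRootCoeff b hb σ w f) ⟨_, h⟩
  rw [IsRootCoeff.unique hb σ w h2 h]

end Root

/-! ### Truncated Cauchy products and the reduction of `W¹₂` functions to pairs `(f 0, -i f')` -/

theorem sum_fin_prod_ite {m : ℕ} (k : Fin m) (F : ℕ → ℕ → ℂ) :
    (∑ p : Fin m × Fin m, if (p.1 : ℕ) + p.2 = k then F p.1 p.2 else 0) =
      ∑ p ∈ Finset.HasAntidiagonal.antidiagonal (k : ℕ), F p.1 p.2 := by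
  rw [← Finset.sum_filter]
  refine Finset.sum_bij (fun p _ => ((p.1 : ℕ), (p.2 : ℕ))) ?_ ?_ ?_ ?_
  · intro p hp
    simpa using hp
  · intro p _ q _ h
    rw [Prod.mk.injEq] at h
    exact Prod.ext (Fin.ext h.1) (Fin.ext h.2)
  · intro p hp
    have hp := Finset.HasAntidiagonal.mem_antidiagonal.1 hp
    have hk := k.2
    exact ⟨(⟨p.1, by omega⟩, ⟨p.2, by omega⟩), by simpa using hp, rfl⟩
  · intro p _
    rfl

theorem IsW12.eqOn_extFn {b : ℝ} {f : ℝ → ℂ} (hf : IsW12 b f) :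
    EqOn f (extFn (f 0) (negIDeriv f hf)) (Icc 0 b) := fun x hx => by
  rw [extFn_eq _ _ hx, ← eq_primFn_of_isW12 hf hx]

theorem IsW12.toLp_eq {b : ℝ} {f : ℝ → ℂ} (hf : IsW12 b f) :
    hf.memLp.toLp f = f 0 • oneL b + volt b (negIDeriv f hf) := by
  refine Lp.ext ?_
  filter_upwards [hf.memLp.coeFn_toLp, Lp.coeFn_add (f 0 • oneL b) (volt b (negIDeriv f hf)),
    Lp.coeFn_smul (f 0) (oneL b), oneL_ae b, volt_ae (negIDeriv f hf), ae_mem_Ioo b]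
    with x h1 h2 h3 h4 h5 h6
  rw [h1, h2, Pi.add_apply, h3, Pi.smul_apply, h4, h5, smul_eq_mul, mul_one,
    ← eq_primFn_of_isW12 hf (Ioo_subset_Icc_self h6)]

theorem IsW12.conv_ae {b : ℝ} (hb : 0 < b) (σ : L2 b) {f g : ℝ → ℂ} (hf : IsW12 b f)
    (hg : IsW12 b g) : conv b σ f g =ᵐ[μI b]
      convL hb σ (continuous_extFn (g 0) (negIDeriv g hg)) (f 0, negIDeriv f hf) := by
  filter_upwards [convL_ae hb σ (continuous_extFn (g 0) (negIDeriv g hg)) (f 0) (negIDeriv f hf),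
    ae_mem_Ioo b] with x h1 h2
  rw [h1, conv_congr hb.le σ hf.eqOn_extFn hg.eqOn_extFn (Ioo_subset_Icc_self h2)]

end BoundaryConv

end

theorem theorem3p1 (b : ℝ) (hb : 0 < b) (σ : BoundaryConv.L2 b) :
    (∀ w ∈ BoundaryConv.spec (BoundaryConv.Lop b hb σ),
      (∃ δ : ℝ, BoundaryConv.IsIsolatingRadius (BoundaryConv.Lop b hb σ) w δ) ∧
      ∀ f : BoundaryConv.L2 b,
        ∃! c : Fin (BoundaryConv.mult b σ w) → ℂ, BoundaryConv.IsRootCoeff b hb σ w f c) ∧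
    ∀ (f g : ℝ → ℂ) (hf : BoundaryConv.IsW12 b f) (hg : BoundaryConv.IsW12 b g),
      ∃ hfg : MeasureTheory.MemLp (BoundaryConv.conv b σ f g) 2 (BoundaryConv.μI b),
        BoundaryConv.fourier b hb σ (hfg.toLp (BoundaryConv.conv b σ f g)) =
          BoundaryConv.cauchyProd
            (BoundaryConv.fourier b hb σ (hf.memLp.toLp f))
            (BoundaryConv.fourier b hb σ (hg.memLp.toLp g)) := by
  open BoundaryConv in
  have hV := isUnit_one_sub_smul_volt (b := b)
  refine ⟨fun w hw => ⟨?_, fun f => ?_⟩, fun f g hf hg => ?_⟩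
  · obtain ⟨δ, hδ, h⟩ := exists_pertDet_ne_zero hV (sigFun σ) (oneL b) w
    exact ⟨δ, hδ, fun z hz hz' => h z hz' ((mem_spec_Lop hb σ z).1 hz)⟩
  · exact ⟨_, isRootCoeff_coefFun hb σ w hw f, fun c hc =>
      IsRootCoeff.unique hb σ w hc (isRootCoeff_coefFun hb σ w hw f)⟩
  -- Only values on `[0, b]` matter, so `g` may be replaced by a function continuous on the whole
  -- line, as the operator bounds require.
  · set G := extFn (g 0) (negIDeriv g hg) with hG
    have hGc : Continuous G := continuous_extFn _ _
    have hae := hf.conv_ae hb σ hg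
    have hfg : MemLp (conv b σ f g) 2 (μI b) := (Lp.memLp _).ae_eq hae.symm
    refine ⟨hfg, ?_⟩
    have e1 : hfg.toLp (conv b σ f g) = convL hb σ hGc (f 0, negIDeriv f hf) :=
      Lp.ext (hfg.coeFn_toLp.trans hae)
    have e2 : hg.memLp.toLp g = ofCont b G hGc := by
      refine Lp.ext ?_
      filter_upwards [hg.memLp.coeFn_toLp, ofCont_ae (b := b) hGc, ae_mem_Ioo b] with x h1 h2 h3
      rw [h1, h2, hg.eqOn_extFn (Ioo_subset_Icc_self h3)]
    funext w k
    have hm := iteratedDeriv_pertDet_eq_zero hV (sigFun σ) (oneL b) w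
    rw [← mult_eq σ w hb.le] at hm
    simp only [cauchyProd, fourier_eq_coefFun]
    rw [sum_fin_prod_ite k (fun i j => coefFun (volt b) (sigFun σ) w i (hf.memLp.toLp f) *
        coefFun (volt b) (sigFun σ) w j (hg.memLp.toLp g)), e1, e2, hf.toLp_eq,
      coefFun_convL hb σ hGc k.2 ((mem_spec_Lop hb σ w).1 w.2) hm]
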